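/- Let $Z=(Z_t)_{t\ge 0}$ be a real-valued Lévy process without Gaussian component, so that $\mathsf{E}e^{i\xi Z_t}=e^{-t\psi(\xi)}$ for $t\ge 0$, $\xi\in\mathbb{R}$, with $$\psi(\xi)=ia\xi+\int_{\mathbb{R}}\bigl(1-e^{i\xi u}+i\xi u\,1_{\{|u|<1\}}\bigr)\,\mu(du),$$ where $a\in\mathbb{R}$ and $\mu$ is a Lévy measure, i.e. $\mu(\{0\})=0$ and $\int_{\mathbb{R}}(1\wedge u^2)\,\mu(du)<\infty$. Assume $\mu(\mathbb{R})=\infty$ and the following condition. **A.** There is $\beta>1$ such that $\psi^U(\xi)\le\beta\,\psi^L(\xi)$ for all $\xi\in\mathbb{R}$, where $\psi^L(\xi)=\int_{\{|\xi u|<1\}}(\xi u)^2\,\mu(du)$ and $\psi^U(\xi)=\int_{\mathbb{R}}\bigl((\xi u)^2\wedge 1\bigr)\,\mu(du)$. For $t>0$ put $$\rho_t=\inf\{\xi>0:\ \mathrm{Re}\,\psi(\xi)\ge 1/t\},\qquad \Lambda_t(du)=t\,1_{\{|\rho_t u|>1\}}\,\mu(du),\qquad a_t=t\Bigl(a+\int_{\{1/\rho_t<|u|<1\}}u\,\mu(du)\Bigr).$$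 Then for every $t>0$ the law of $Z_t$ has an infinitely differentiable density $p_t$, and for every integer $k\ge 1$ and every $t_0>0$ there are constants $b_1,b_2>0$ such that the function $\bigl|\frac{\partial^k}{\partial x^k}p_t(x-a_t)\bigr|$ satisfies on $(0,t_0]\times\mathbb{R}$ the upper compound kernel estimate with parameters $(\rho_t^{k+1},\,f_{upper},\,\rho_t,\,\Lambda_t)$, $f_{upper}(x)=b_1e^{-b_2|x|}$; that is, the measures $\Lambda_t$ are finite and, for all $t\in(0,t_0]$ and $x\in\mathbb{R}$, $$\Bigl|\frac{\partial^k}{\partial x^k}p_t(x-a_t)\Bigr|\le\sum_{m=0}^\infty\frac1{m!}\int_{\mathbb{R}}\rho_t^{k+1}\,b_1e^{-b_2\rho_t|x-y|}\,\Lambda_t^{*m}(dy)<\infty,$$ where $\Lambda_t^{*m}$ is the $m$-fold convolution power of $\Lambda_t$ and $\Lambda_t^{*0}=\delta_0$. -/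

import Mathlib

open MeasureTheory ProbabilityTheory Filter
open scoped Topology NNReal ENNReal

noncomputable section

namespace CompoundKernel

/-- `Z` is a real-valued Lévy process under `P`: it starts at `0`, has independent and stationary
increments, and is stochastically continuous (which càdlàg paths imply). -/
structure IsLevyProcess {Ω : Type*} [MeasurableSpace Ω] (Z : ℝ≥0 → Ω → ℝ) (P : Measure Ω) :
    Prop where
  measurable : ∀ t, Measurable (Z t)
  zero : ∀ᵐ ω ∂P, Z 0 ω = 0
  indep : HasIndepIncrements Z P
  stationary : ∀ s h : ℝ≥0, IdentDistrib (fun ω => Z (s + h) ω - Z s ω) (Z h) P P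
  stoch_cont : ∀ t : ℝ≥0, TendstoInMeasure P Z (𝓝 t) (Z t)

/-- `μ` is a Lévy measure on `ℝ`. -/
structure IsLevyMeasure (μ : Measure ℝ) : Prop where
  zero : μ {0} = 0
  lintegral_lt_top : ∫⁻ u, ENNReal.ofReal (min 1 (u ^ 2)) ∂μ < ∞

/-- The characteristic exponent without Gaussian part,
`ψ(ξ) = iaξ + ∫ (1 - e^{iξu} + iξu 1_{|u|<1}) μ(du)`. -/
def psi (a : ℝ) (μ : Measure ℝ) (ξ : ℝ) : ℂ :=
  Complex.I * a * ξ +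
    ∫ u : ℝ, (1 - Complex.exp (Complex.I * ξ * u) +
      (if |u| < 1 then Complex.I * ξ * u else 0)) ∂μ

/-- `ψ^L(ξ) = ∫_{|ξu|<1} (ξu)² μ(du)`. -/
def psiL (μ : Measure ℝ) (ξ : ℝ) : ℝ := ∫ u in {u : ℝ | |ξ * u| < 1}, (ξ * u) ^ 2 ∂μ

/-- `ψ^U(ξ) = ∫ ((ξu)² ∧ 1) μ(du)`. -/
def psiU (μ : Measure ℝ) (ξ : ℝ) : ℝ := ∫ u : ℝ, min ((ξ * u) ^ 2) 1 ∂μ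

/-- Condition **A**. -/
def ConditionA (μ : Measure ℝ) : Prop := ∃ β : ℝ, 1 < β ∧ ∀ ξ : ℝ, psiU μ ξ ≤ β * psiL μ ξ

/-- `ρ_t = inf {ξ > 0 : Re ψ(ξ) ≥ 1/t}`. -/
def rho (a : ℝ) (μ : Measure ℝ) (t : ℝ≥0) : ℝ :=
  sInf {ξ : ℝ | 0 < ξ ∧ 1 / (t : ℝ) ≤ (psi a μ ξ).re}

/-- `Λ_t(du) = t 1_{|ρ_t u| > 1} μ(du)`. -/
def Lam (a : ℝ) (μ : Measure ℝ) (t : ℝ≥0) : Measure ℝ :=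
  (t : ℝ≥0∞) • μ.restrict {u : ℝ | 1 < |rho a μ t * u|}

/-- `a_t = t (a + ∫_{1/ρ_t < |u| < 1} u μ(du))`. -/
def shift (a : ℝ) (μ : Measure ℝ) (t : ℝ≥0) : ℝ :=
  (t : ℝ) * (a + ∫ u in {u : ℝ | 1 / rho a μ t < |u| ∧ |u| < 1}, u ∂μ)

/-- The `m`-fold convolution power `Q^{*m}`, with `Q^{*0} = δ_0`. -/
def convPow (Q : Measure ℝ) : ℕ → Measure ℝ
  | 0 => Measure.dirac 0
  | m + 1 => (convPow Q m).conv Q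

/-- The function `g` satisfies on `A` the upper compound kernel estimate with parameters
`(σ_t, h, ζ_t, Q_t)`:
`g_t(x) ≤ ∑_{m ≥ 0} (1/m!) ∫ σ_t h((x - y) ζ_t) Q_t^{*m}(dy)` for `(t, x) ∈ A`.
That the measures are finite, that the integrals exist and that the series converges is part of
the definition. -/
def UpperCompoundKernelEstimate (A : Set (ℝ≥0 × ℝ)) (g : ℝ≥0 → ℝ → ℝ)
    (σ : ℝ≥0 → ℝ) (h : ℝ → ℝ) (ζ : ℝ≥0 → ℝ) (Q : ℝ≥0 → Measure ℝ) : Prop :=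
  ∀ t x, (t, x) ∈ A →
    IsFiniteMeasure (Q t) ∧
    (∀ m : ℕ, Integrable (fun y => σ t * h ((x - y) * ζ t)) (convPow (Q t) m)) ∧
    Summable (fun m : ℕ =>
      1 / (m.factorial : ℝ) * ∫ y, σ t * h ((x - y) * ζ t) ∂(convPow (Q t) m)) ∧
    g t x ≤ ∑' m : ℕ,
      1 / (m.factorial : ℝ) * ∫ y, σ t * h ((x - y) * ζ t) ∂(convPow (Q t) m)

/-- `f_upper(x) = b₁ e^{-b₂ |x|}`. -/
def fUpper (b₁ b₂ : ℝ) (x : ℝ) : ℝ := b₁ * Real.exp (-b₂ * |x|)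

/-- `q` is a smooth (`C^∞`) probability density of the law `ν` on `ℝ`; for given `ν` there is at
most one. -/
def IsSmoothDensity (ν : Measure ℝ) (q : ℝ → ℝ) : Prop :=
  ContDiff ℝ ((⊤ : ℕ∞) : WithTop ℕ∞) q ∧ (∀ x, 0 ≤ q x) ∧ ν = volume.withDensity (fun x => ENNReal.ofReal (q x))

end CompoundKernel

end

noncomputable section

namespace CompoundKernel

/-! ### The characteristic exponent under condition A: comparisons, growth, and the scale `rho`. -/

section Levy

variable {μ : Measure ℝ}

/-! Everything is read at the length scale 1/ρ_t. Under A the functions Re ψ, ψ^L and ψ^U are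
comparable, and t Re ψ(ρ_t) = 1, so t ψ^U(ρ_t) lies between two positive constants independent of t
(`mul_psiU_rho_bounds`). At this scale Z_t + a_t splits into three parts (`mul_psi_eq`): the
compensated jumps of size at most 1/ρ_t, a compound Poisson part with intensity Λ_t, and a residual
drift from the jumps with 1 ≤ |u| ≤ 1/ρ_t, which ψ does not compensate.

Small jumps. Rescaled by ρ_t they live in [-1, 1] and have second moment bounded uniformly in t.
Hence their exponent is entire, and the Fourier contour can be moved by distance one, up or down
according to the sign of x, which produces e^{-|x|} (`norm_integral_exp_compExponent_le`). The
integrals converge uniformly in t because A makes ψ^U grow by a fixed factor at each doubling of the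
frequency, hence like a power (`exists_rpow_le_psiU`); the rescaled characteristic function
therefore decays faster than any polynomial (`exists_decay`).

Large jumps. Their factor is e^{-|Λ_t|} times the exponential of the Fourier transform of Λ_t. The
m-th term of the exponential series acts as convolution with Λ_t^{*m}/m!, which gives the compound
kernel (`norm_integral_mul_exp_charFun_le`). The change of frequency and the k derivatives
contribute ρ_t^{k+1}.

The residual drift is a bounded translation in the rescaled variable for t ≤ t₀, so it only enlarges
b₁. The same decay gives smoothness and existence of the density by Fourier inversion
(`isSmoothDensity_inversionDensity`). -/

lemma IsLevyMeasure.integrable_min (hμ : IsLevyMeasure μ) :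
    Integrable (fun u : ℝ => min 1 (u ^ 2)) μ := by
  refine ⟨by fun_prop, ?_⟩
  rw [hasFiniteIntegral_iff_ofReal (ae_of_all _ fun u => le_min zero_le_one (sq_nonneg u))]
  exact hμ.lintegral_lt_top

lemma IsLevyMeasure.integrable_of_le {E : Type*} [NormedAddCommGroup E] (hμ : IsLevyMeasure μ)
    {f : ℝ → E} (hf : AEStronglyMeasurable f μ) (C : ℝ) (h : ∀ u, ‖f u‖ ≤ C * min 1 (u ^ 2)) :
    Integrable f μ :=
  (hμ.integrable_min.const_mul C).mono' hf (ae_of_all _ h)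

lemma min_sq_mul_le (ξ u : ℝ) : min ((ξ * u) ^ 2) 1 ≤ (1 + ξ ^ 2) * min 1 (u ^ 2) := by
  rcases le_total 1 (u ^ 2) with h | h
  · rw [min_eq_left h]; have := min_le_right ((ξ * u) ^ 2) 1; nlinarith [sq_nonneg ξ]
  · rw [min_eq_right h]; have := min_le_left ((ξ * u) ^ 2) 1; nlinarith [sq_nonneg ξ, sq_nonneg u]

lemma one_sub_cos_le (x : ℝ) : 1 - Real.cos x ≤ 2 * min (x ^ 2) 1 := by
  rcases le_total (x ^ 2) 1 with h | h
  · rw [min_eq_left h]; nlinarith [Real.one_sub_sq_div_two_le_cos (x := x), sq_nonneg x]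
  · rw [min_eq_right h]; linarith [Real.neg_one_le_cos x]

lemma sq_le_one_sub_cos {x : ℝ} (hx : |x| ≤ 1) : x ^ 2 / 6 ≤ 1 - Real.cos x := by
  have h1 : x ^ 2 ≤ 1 := by rw [← sq_abs]; nlinarith [abs_nonneg x]
  have := Real.cos_bound hx
  have h2 := (abs_le.mp this).2
  have h3 : |x| ^ 4 = (x ^ 2) ^ 2 := by rw [← sq_abs x]; ring
  rw [h3] at h2
  nlinarith [sq_nonneg x]

lemma IsLevyMeasure.integrable_min_sq_mul (hμ : IsLevyMeasure μ) (ξ : ℝ) :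
    Integrable (fun u : ℝ => min ((ξ * u) ^ 2) 1) μ := by
  refine hμ.integrable_of_le (by fun_prop) (1 + ξ ^ 2) fun u => ?_
  rw [Real.norm_of_nonneg (le_min (sq_nonneg _) zero_le_one)]
  exact min_sq_mul_le ξ u

lemma IsLevyMeasure.integrable_one_sub_cos (hμ : IsLevyMeasure μ) (ξ : ℝ) :
    Integrable (fun u : ℝ => 1 - Real.cos (ξ * u)) μ := by
  refine ((hμ.integrable_min_sq_mul ξ).const_mul 2).mono' (by fun_prop) (ae_of_all _ fun u => ?_)
  rw [Real.norm_of_nonneg (by linarith [Real.cos_le_one (ξ * u)])]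
  exact one_sub_cos_le _

/-- Second-order Taylor remainder, for complex z so that it also serves on shifted contours. -/
lemma norm_one_sub_exp_add_le (z : ℂ) :
    ‖1 - Complex.exp z + z‖ ≤ ‖z‖ ^ 2 * Real.exp ‖z‖ := by
  have := Complex.norm_exp_sub_sum_le_norm_mul_exp z 2
  simp only [Finset.sum_range_succ, Finset.range_zero, Finset.sum_empty] at this
  convert this using 1
  rw [← norm_neg]; congr 1; simp; ring

lemma norm_one_sub_exp_I_le (x : ℝ) : ‖1 - Complex.exp (Complex.I * x)‖ ≤ 2 := by
  refine (norm_sub_le _ _).trans ?_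
  rw [mul_comm, Complex.norm_exp_ofReal_mul_I]; norm_num

lemma IsLevyMeasure.integrable_psi (hμ : IsLevyMeasure μ) (ξ : ℝ) :
    Integrable (fun u : ℝ => 1 - Complex.exp (Complex.I * ξ * u) +
      (if |u| < 1 then Complex.I * ξ * u else 0)) μ := by
  refine hμ.integrable_of_le ?_ (2 + ξ ^ 2 * Real.exp |ξ|) fun u => ?_
  · refine Measurable.aestronglyMeasurable ?_
    refine Measurable.add (by fun_prop) (Measurable.ite ?_ (by fun_prop) (by fun_prop))
    exact measurableSet_lt (by fun_prop) (by fun_prop)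
  · have e : Complex.I * ξ * u = Complex.I * ((ξ * u : ℝ) : ℂ) := by push_cast; ring
    split_ifs with h
    · have h1 : u ^ 2 ≤ 1 := by rw [← sq_abs]; nlinarith [abs_nonneg u]
      rw [min_eq_right h1]
      refine (norm_one_sub_exp_add_le _).trans ?_
      have hn : ‖Complex.I * ξ * u‖ = |ξ| * |u| := by simp
      rw [hn]
      have : Real.exp (|ξ| * |u|) ≤ Real.exp |ξ| :=
        Real.exp_le_exp.mpr (by nlinarith [abs_nonneg ξ])
      calc (|ξ| * |u|) ^ 2 * Real.exp (|ξ| * |u|) ≤ (|ξ| * |u|) ^ 2 * Real.exp |ξ| := by gcongr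
        _ = (ξ ^ 2 * Real.exp |ξ|) * u ^ 2 := by rw [mul_pow, sq_abs, sq_abs]; ring
        _ ≤ _ := by nlinarith [sq_nonneg u]
    · have h1 : 1 ≤ u ^ 2 := by rw [← sq_abs]; nlinarith [abs_nonneg u]
      rw [min_eq_left h1, add_zero, e]
      refine (norm_one_sub_exp_I_le _).trans ?_
      have : 0 ≤ ξ ^ 2 * Real.exp |ξ| := by positivity
      linarith

lemma exp_I_mul_re (x : ℝ) : (Complex.exp (Complex.I * x)).re = Real.cos x := by
  rw [mul_comm, Complex.exp_ofReal_mul_I_re]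

lemma psi_re (hμ : IsLevyMeasure μ) (a ξ : ℝ) :
    (psi a μ ξ).re = ∫ u, (1 - Real.cos (ξ * u)) ∂μ := by
  have h := integral_re (hμ.integrable_psi ξ)
  simp only [RCLike.re_eq_complex_re] at h
  rw [psi, Complex.add_re, ← h]
  have : (Complex.I * a * ξ).re = 0 := by simp
  rw [this, zero_add]
  refine integral_congr_ae (ae_of_all _ fun u => ?_)
  have e : Complex.I * ξ * u = Complex.I * ((ξ * u : ℝ) : ℂ) := by push_cast; ring
  simp only [e, Complex.add_re, Complex.sub_re, Complex.one_re, exp_I_mul_re]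
  split_ifs <;> simp

lemma measurableSet_abs_mul_lt (ξ c : ℝ) : MeasurableSet {u : ℝ | |ξ * u| < c} :=
  measurableSet_lt (by fun_prop) (by fun_prop)

lemma IsLevyMeasure.integrableOn_sq (hμ : IsLevyMeasure μ) (ξ : ℝ) :
    IntegrableOn (fun u : ℝ => (ξ * u) ^ 2) {u : ℝ | |ξ * u| < 1} μ := by
  refine (hμ.integrable_min_sq_mul ξ).integrableOn.mono' (by fun_prop) ?_
  refine (ae_restrict_iff' (measurableSet_abs_mul_lt ξ 1)).mpr (ae_of_all _ fun u hu => ?_)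
  have hu : |ξ * u| < 1 := hu
  rw [Real.norm_of_nonneg (sq_nonneg _), min_eq_left]
  rw [← sq_abs]; nlinarith [abs_nonneg (ξ * u)]

/-- Common source of the lower bounds by ψ^L: applied to 1 - cos(ξu), and to the increment of the
truncated square when the frequency is doubled. -/
lemma psiL_le_integral (hμ : IsLevyMeasure μ) {f : ℝ → ℝ} (hf : Integrable f μ) (hf0 : ∀ u, 0 ≤ f u)
    (ξ c : ℝ) (h : ∀ u, |ξ * u| < 1 → c * (ξ * u) ^ 2 ≤ f u) :
    c * psiL μ ξ ≤ ∫ u, f u ∂μ := by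
  rw [psiL, ← integral_const_mul]
  refine le_trans ?_ (setIntegral_le_integral (s := {u : ℝ | |ξ * u| < 1}) hf (ae_of_all _ hf0))
  exact setIntegral_mono_on ((hμ.integrableOn_sq ξ).const_mul c) hf.integrableOn
    (measurableSet_abs_mul_lt ξ 1) h

lemma psiL_le_re_psi (hμ : IsLevyMeasure μ) (a ξ : ℝ) : psiL μ ξ ≤ 6 * (psi a μ ξ).re := by
  rw [psi_re hμ]
  have := psiL_le_integral hμ (hμ.integrable_one_sub_cos ξ)
    (fun u => by linarith [Real.cos_le_one (ξ * u)]) ξ (1 / 6) fun u hu => by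
      linarith [sq_le_one_sub_cos hu.le]
  linarith

lemma re_psi_le_psiU (hμ : IsLevyMeasure μ) (a ξ : ℝ) : (psi a μ ξ).re ≤ 2 * psiU μ ξ := by
  rw [psi_re hμ, psiU, ← integral_const_mul]
  exact integral_mono (hμ.integrable_one_sub_cos ξ) ((hμ.integrable_min_sq_mul ξ).const_mul 2)
    fun u => one_sub_cos_le _

lemma psiU_nonneg (ξ : ℝ) : 0 ≤ psiU μ ξ :=
  integral_nonneg fun _ => le_min (sq_nonneg _) zero_le_one

lemma psiU_mono (hμ : IsLevyMeasure μ) {ξ η : ℝ} (h : |ξ| ≤ |η|) : psiU μ ξ ≤ psiU μ η := by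
  refine integral_mono (hμ.integrable_min_sq_mul ξ) (hμ.integrable_min_sq_mul η) fun u => ?_
  have : (ξ * u) ^ 2 ≤ (η * u) ^ 2 := by
    rw [mul_pow, mul_pow]; exact mul_le_mul_of_nonneg_right (sq_le_sq.mpr h) (sq_nonneg u)
  exact min_le_min_right 1 this

/-- Doubling the frequency increases `ψ^U` by a fixed factor. -/
lemma psiU_le_mul_psiU_two_mul (hμ : IsLevyMeasure μ) {β : ℝ} (hβ : 1 < β)
    (h : ∀ ξ, psiU μ ξ ≤ β * psiL μ ξ) (ξ : ℝ) :
    psiU μ ξ ≤ (1 - 3 / (4 * β)) * psiU μ (2 * ξ) := by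
  -- Where |2ξu| < 1 neither square is truncated, and the difference is exactly 3/4 of (2ξu)².
  have h1 : (3 / 4 : ℝ) * psiL μ (2 * ξ) ≤
      ∫ u, (min ((2 * ξ * u) ^ 2) 1 - min ((ξ * u) ^ 2) 1) ∂μ := by
    refine psiL_le_integral hμ
      ((hμ.integrable_min_sq_mul (2 * ξ)).sub (hμ.integrable_min_sq_mul ξ)) (fun u => ?_) _ _
      fun u hu => ?_
    · have : (ξ * u) ^ 2 ≤ (2 * ξ * u) ^ 2 := by nlinarith [sq_nonneg (ξ * u)]
      exact sub_nonneg.mpr (min_le_min_right 1 this)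
    · have : (2 * ξ * u) ^ 2 < 1 := by rw [← sq_abs]; nlinarith [abs_nonneg (2 * ξ * u)]
      rw [Pi.sub_apply, min_eq_left this.le, min_eq_left (by nlinarith [sq_nonneg (ξ * u)])]
      linarith [sq_nonneg (ξ * u)]
  rw [integral_sub (hμ.integrable_min_sq_mul (2 * ξ)) (hμ.integrable_min_sq_mul ξ)] at h1
  change _ ≤ psiU μ (2 * ξ) - psiU μ ξ at h1
  have h2 := h (2 * ξ)
  have h3 : 3 / (4 * β) * psiU μ (2 * ξ) ≤ 3 / 4 * psiL μ (2 * ξ) := by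
    rw [div_mul_eq_mul_div, div_le_iff₀ (by linarith)]; linarith
  linarith

/-- Condition **A** forces power growth of `ψ^U`. -/
lemma exists_rpow_le_psiU (hμ : IsLevyMeasure μ) (hA : ConditionA μ) :
    ∃ c α : ℝ, 0 < c ∧ 0 < α ∧ ∀ ξ s : ℝ, 1 ≤ |s| →
      c * |s| ^ α * psiU μ ξ ≤ psiU μ (s * ξ) := by
  obtain ⟨β, hβ, h⟩ := hA
  set q : ℝ := 1 - 3 / (4 * β) with hq
  have hb : 3 / (4 * β) < 1 := by rw [div_lt_one (by linarith)]; linarith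
  have hb' : 0 < 3 / (4 * β) := by positivity
  have hq0 : 0 < q := by linarith
  have hQ : 1 < q⁻¹ := (one_lt_inv₀ hq0).mpr (by linarith)
  have hQ0 : 0 < q⁻¹ := by positivity
  have step : ∀ ξ, q⁻¹ * psiU μ ξ ≤ psiU μ (2 * ξ) := fun ξ => by
    rw [inv_mul_le_iff₀ hq0]; exact psiU_le_mul_psiU_two_mul hμ hβ h ξ
  have pow : ∀ (n : ℕ) ξ, q⁻¹ ^ n * psiU μ ξ ≤ psiU μ (2 ^ n * ξ) := by
    intro n ξ
    induction n with
    | zero => simp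
    | succ n ih =>
      calc q⁻¹ ^ (n + 1) * psiU μ ξ = q⁻¹ * (q⁻¹ ^ n * psiU μ ξ) := by ring
        _ ≤ q⁻¹ * psiU μ (2 ^ n * ξ) := by gcongr
        _ ≤ psiU μ (2 * (2 ^ n * ξ)) := step _
        _ = _ := by congr 1; ring
  have h2α : (2 : ℝ) ^ Real.logb 2 q⁻¹ = q⁻¹ := Real.rpow_logb (by norm_num) (by norm_num) hQ0
  have hα : 0 < Real.logb 2 q⁻¹ := Real.logb_pos (by norm_num) hQ
  -- The exponent is chosen so that 2^α = 1/q; the constant q pays for rounding |s| down to a power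
  -- of 2.
  refine ⟨q, Real.logb 2 q⁻¹, hq0, hα, fun ξ s hs => ?_⟩
  obtain ⟨n, hn1, hn2⟩ := exists_nat_pow_near hs (one_lt_two (α := ℝ))
  have h3 : |s| ^ Real.logb 2 q⁻¹ ≤ q⁻¹ ^ (n + 1) := by
    calc |s| ^ Real.logb 2 q⁻¹ ≤ ((2 : ℝ) ^ (n + 1)) ^ Real.logb 2 q⁻¹ :=
          Real.rpow_le_rpow (abs_nonneg s) hn2.le hα.le
      _ = ((2 : ℝ) ^ Real.logb 2 q⁻¹) ^ (n + 1) := by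
          rw [← Real.rpow_natCast, ← Real.rpow_natCast, ← Real.rpow_mul (by norm_num),
            ← Real.rpow_mul (by norm_num), mul_comm]
      _ = _ := by rw [h2α]
  have h4 : q * |s| ^ Real.logb 2 q⁻¹ ≤ q⁻¹ ^ n := by
    calc _ ≤ q * q⁻¹ ^ (n + 1) := by gcongr
      _ = _ := by rw [pow_succ]; field_simp
  calc _ ≤ q⁻¹ ^ n * psiU μ ξ := mul_le_mul_of_nonneg_right h4 (psiU_nonneg ξ)
    _ ≤ psiU μ (2 ^ n * ξ) := pow n ξ
    _ ≤ psiU μ (s * ξ) := psiU_mono hμ (by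
        rw [abs_mul, abs_mul, abs_of_pos (by positivity : (0 : ℝ) < 2 ^ n)]; gcongr)

lemma psiU_one_pos (hμ : IsLevyMeasure μ) (h0 : μ ≠ 0) : 0 < psiU μ 1 := by
  rw [psiU, integral_pos_iff_support_of_nonneg (fun u => le_min (sq_nonneg _) zero_le_one)
    (hμ.integrable_min_sq_mul 1)]
  have : (Function.support fun u : ℝ => min ((1 * u) ^ 2) 1) = {0}ᶜ := by
    ext u
    rw [Function.mem_support, Set.mem_compl_singleton_iff]
    refine ⟨fun h hu => h (by simp [hu]), fun h => (lt_min (by positivity) one_pos).ne'⟩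
  rw [this, pos_iff_ne_zero]
  intro h
  apply h0
  rw [← Measure.measure_univ_eq_zero, ← Set.union_compl_self {(0 : ℝ)}]
  exact measure_union_null hμ.zero h

lemma continuous_re_psi (hμ : IsLevyMeasure μ) (a : ℝ) : Continuous fun ξ => (psi a μ ξ).re := by
  simp only [psi_re hμ]
  rw [continuous_iff_continuousAt]
  intro ξ₀
  refine continuousAt_of_dominated (bound := fun u => 2 * ((1 + (|ξ₀| + 1) ^ 2) * min 1 (u ^ 2)))
    (Eventually.of_forall fun ξ => by fun_prop) ?_ ((hμ.integrable_min.const_mul _).const_mul _)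
    (ae_of_all _ fun u => by fun_prop)
  filter_upwards [Metric.ball_mem_nhds ξ₀ one_pos] with ξ hξ
  refine ae_of_all _ fun u => ?_
  rw [Real.norm_of_nonneg (by linarith [Real.cos_le_one (ξ * u)])]
  refine (one_sub_cos_le _).trans ?_
  have h1 : |ξ| ≤ |ξ₀| + 1 := by
    have := abs_sub_abs_le_abs_sub ξ ξ₀
    rw [Metric.mem_ball, Real.dist_eq] at hξ; linarith
  have h2 : ξ ^ 2 ≤ (|ξ₀| + 1) ^ 2 := sq_le_sq.mpr (by
    rwa [abs_of_nonneg (by positivity : 0 ≤ |ξ₀| + 1)])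
  have h3 : 0 ≤ min 1 (u ^ 2) := le_min zero_le_one (sq_nonneg u)
  have := min_sq_mul_le ξ u
  nlinarith

/-- Power growth of ψ^U passes to Re ψ through A, so the set whose infimum is `rho` is nonempty. -/
lemma exists_le_re_psi (hμ : IsLevyMeasure μ) (h0 : μ ≠ 0) (hA : ConditionA μ) (a y : ℝ) :
    ∃ ξ, 0 < ξ ∧ y ≤ (psi a μ ξ).re := by
  obtain ⟨c, α, hc, hα, h⟩ := exists_rpow_le_psiU hμ hA
  obtain ⟨β, hβ, hA⟩ := hA
  have hU := psiU_one_pos hμ h0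
  have := (tendsto_rpow_atTop hα).eventually_ge_atTop (6 * β * |y| / (c * psiU μ 1))
  obtain ⟨s, hs, hs1⟩ := (this.and (eventually_ge_atTop 1)).exists
  refine ⟨s, by linarith, ?_⟩
  have h1 := h 1 s (by rw [abs_of_nonneg (by linarith)]; exact hs1)
  rw [abs_of_nonneg (by linarith), mul_one] at h1
  have h2 := hA s
  have h3 := psiL_le_re_psi hμ a s
  rw [div_le_iff₀ (by positivity)] at hs
  have h4 : β * psiL μ s ≤ β * (6 * (psi a μ s).re) := by gcongr
  have h5 : 6 * β * |y| ≤ 6 * β * (psi a μ s).re := by linarith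
  exact (le_abs_self y).trans (le_of_mul_le_mul_left h5 (by linarith))

/-- By continuity the infimum is attained, and the opposite inequality on (0, ρ_t) extends to the
endpoint; ρ_t = 0 is excluded since Re ψ(0) = 0. -/
lemma rho_pos_and_re_psi_rho (hμ : IsLevyMeasure μ) (h0 : μ ≠ 0) (hA : ConditionA μ) (a : ℝ)
    {t : ℝ≥0} (ht : 0 < t) :
    0 < rho a μ t ∧ (t : ℝ) * (psi a μ (rho a μ t)).re = 1 := by
  have ht' : (0 : ℝ) < t := ht
  set S : Set ℝ := {ξ : ℝ | 0 < ξ ∧ 1 / (t : ℝ) ≤ (psi a μ ξ).re} with hS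
  have hne : S.Nonempty := exists_le_re_psi hμ h0 hA a _
  have hbd : BddBelow S := ⟨0, fun x hx => hx.1.le⟩
  have hρ : rho a μ t = sInf S := rfl
  have hcont := continuous_re_psi hμ a
  have hmem : rho a μ t ∈ closure S := csInf_mem_closure hne hbd
  have hge : 1 / (t : ℝ) ≤ (psi a μ (rho a μ t)).re := by
    have hcl : IsClosed {ξ | 1 / (t : ℝ) ≤ (psi a μ ξ).re} := isClosed_le continuous_const hcont
    exact closure_minimal (fun x hx => hx.2) hcl hmem
  have hnn : 0 ≤ rho a μ t := le_csInf hne fun x hx => hx.1.le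
  have hpos : 0 < rho a μ t := by
    refine lt_of_le_of_ne hnn fun h => ?_
    rw [← h, psi_re hμ] at hge
    simp only [zero_mul, Real.cos_zero, sub_self, integral_zero] at hge
    have : 0 < 1 / (t : ℝ) := by positivity
    linarith
  refine ⟨hpos, ?_⟩
  have hle : (psi a μ (rho a μ t)).re ≤ 1 / (t : ℝ) := by
    have hcl : IsClosed {ξ | (psi a μ ξ).re ≤ 1 / (t : ℝ)} := isClosed_le hcont continuous_const
    have hsub : Set.Ioo 0 (rho a μ t) ⊆ {ξ | (psi a μ ξ).re ≤ 1 / (t : ℝ)} := by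
      intro x hx
      by_contra hx'
      exact absurd (csInf_le hbd (show x ∈ S from ⟨hx.1, (not_le.mp hx').le⟩)) (not_le.mpr hx.2)
    refine closure_minimal hsub hcl ?_
    rw [closure_Ioo hpos.ne]
    exact ⟨hpos.le, le_rfl⟩
  rw [le_antisymm hle hge]
  field_simp

lemma IsLevyMeasure.one_lt_abs_mul_lt_top (hμ : IsLevyMeasure μ) (ξ : ℝ) :
    μ {u : ℝ | 1 < |ξ * u|} < ∞ := by
  refine lt_of_le_of_lt (measure_mono fun u hu => ?_)
    ((hμ.integrable_min_sq_mul ξ).measure_ge_lt_top one_pos)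
  have hu : 1 < |ξ * u| := hu
  change 1 ≤ min ((ξ * u) ^ 2) 1
  refine le_min ?_ le_rfl
  rw [← sq_abs]; nlinarith

lemma measureReal_one_lt_abs_mul_le (hμ : IsLevyMeasure μ) (ξ : ℝ) :
    μ.real {u : ℝ | 1 < |ξ * u|} ≤ psiU μ ξ := by
  have hm : MeasurableSet {u : ℝ | 1 < |ξ * u|} := measurableSet_lt (by fun_prop) (by fun_prop)
  calc μ.real {u : ℝ | 1 < |ξ * u|} = ∫ u in {u : ℝ | 1 < |ξ * u|}, (1 : ℝ) ∂μ := by simp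
    _ ≤ ∫ u in {u : ℝ | 1 < |ξ * u|}, min ((ξ * u) ^ 2) 1 ∂μ := by
        refine setIntegral_mono_on (integrableOn_const (hμ.one_lt_abs_mul_lt_top ξ).ne)
          (hμ.integrable_min_sq_mul ξ).integrableOn hm fun u hu => ?_
        have hu : 1 < |ξ * u| := hu
        refine le_min ?_ le_rfl
        rw [← sq_abs]; nlinarith
    _ ≤ psiU μ ξ := setIntegral_le_integral (hμ.integrable_min_sq_mul ξ)
        (ae_of_all _ fun _ => le_min (sq_nonneg _) zero_le_one)

/-- The normalization t Re ψ(ρ_t) = 1 carried over to ψ^U; this is the source of all uniformity in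
t. -/
lemma mul_psiU_rho_bounds (hμ : IsLevyMeasure μ) (h0 : μ ≠ 0) (hA : ConditionA μ) (a : ℝ) :
    ∃ K : ℝ, 0 < K ∧ ∀ t : ℝ≥0, 0 < t →
      1 / 2 ≤ (t : ℝ) * psiU μ (rho a μ t) ∧ (t : ℝ) * psiU μ (rho a μ t) ≤ K := by
  have hA' := hA
  obtain ⟨β, hβ, hA⟩ := hA
  refine ⟨6 * β, by linarith, fun t ht => ?_⟩
  have h1 := (rho_pos_and_re_psi_rho hμ h0 hA' a ht).2
  have ht' : (0 : ℝ) < t := ht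
  have h2 := re_psi_le_psiU hμ a (rho a μ t)
  have h3 := psiL_le_re_psi hμ a (rho a μ t)
  have h4 := hA (rho a μ t)
  constructor
  · have : (t : ℝ) * (psi a μ (rho a μ t)).re ≤ t * (2 * psiU μ (rho a μ t)) := by gcongr
    linarith
  · calc (t : ℝ) * psiU μ (rho a μ t) ≤ t * (β * (6 * (psi a μ (rho a μ t)).re)) := by
          gcongr; exact h4.trans (by gcongr)
      _ = 6 * β * (t * (psi a μ (rho a μ t)).re) := by ring
      _ = _ := by rw [h1, mul_one]

/-- Truncating the large jumps lowers `t Re ψ` by at most twice their intensity. -/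
lemma re_psi_le_setIntegral_add (hμ : IsLevyMeasure μ) (a ξ ρ : ℝ) :
    (psi a μ ξ).re ≤ (∫ u in {u : ℝ | |ρ * u| ≤ 1}, (1 - Real.cos (ξ * u)) ∂μ) +
      2 * psiU μ ρ := by
  have hm : MeasurableSet {u : ℝ | |ρ * u| ≤ 1} := measurableSet_le (by fun_prop) (by fun_prop)
  rw [psi_re hμ, ← integral_add_compl hm (hμ.integrable_one_sub_cos ξ)]
  have hc : {u : ℝ | |ρ * u| ≤ 1}ᶜ = {u : ℝ | 1 < |ρ * u|} := by ext; simp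
  have : ∫ u in {u : ℝ | 1 < |ρ * u|}, (1 - Real.cos (ξ * u)) ∂μ ≤
      ∫ u in {u : ℝ | 1 < |ρ * u|}, (2 : ℝ) ∂μ := by
    refine setIntegral_mono (hμ.integrable_one_sub_cos ξ).integrableOn
      (integrableOn_const (hμ.one_lt_abs_mul_lt_top ρ).ne) fun u => ?_
    simp only
    linarith [Real.neg_one_le_cos (ξ * u)]
  rw [hc]
  have h2 := measureReal_one_lt_abs_mul_le hμ ρ
  simp only [integral_const, smul_eq_mul, MeasurableSet.univ, measureReal_restrict_apply,
    Set.univ_inter] at this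
  linarith

/-- The substitution y = s^α reduces the tail to y^{N/α} e^{-cy} → 0; compactness covers the rest.
-/
lemma exists_pow_mul_exp_neg_le {c α : ℝ} (hc : 0 < c) (hα : 0 < α) (N : ℕ) :
    ∃ C : ℝ, ∀ s : ℝ, 1 ≤ s → s ^ N * Real.exp (-(c * s ^ α)) ≤ C := by
  have h := tendsto_rpow_mul_exp_neg_mul_atTop_nhds_zero (N / α) c hc
  have h2 := h.comp (tendsto_rpow_atTop hα)
  obtain ⟨M, hM⟩ := (h2.eventually_le_const (zero_lt_one)).exists_forall_of_atTop
  have hcont : ContinuousOn (fun s : ℝ => s ^ N * Real.exp (-(c * s ^ α))) (Set.Icc 1 (max 1 M)) := by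
    intro s hs
    have : s ≠ 0 := by linarith [hs.1]
    exact (ContinuousAt.mul (by fun_prop) (Real.continuous_exp.continuousAt.comp
      ((continuousAt_const.mul (Real.continuousAt_rpow_const s α (Or.inl this))).neg))).continuousWithinAt
  obtain ⟨B, hB⟩ := isCompact_Icc.bddAbove_image hcont
  refine ⟨max B 1, fun s hs => ?_⟩
  rcases le_total s (max 1 M) with hsm | hsm
  · exact (hB ⟨s, ⟨hs, hsm⟩, rfl⟩).trans (le_max_left _ _)
  · have := hM s ((le_max_right _ _).trans hsm)
    simp only [Function.comp] at this
    rw [← Real.rpow_mul (by linarith), mul_div_cancel₀ _ hα.ne', Real.rpow_natCast] at this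
    rw [neg_mul] at this
    exact this.trans (le_max_right _ _)

/-- Uniform decay, after rescaling by `ρ_t`, of the small-jump part of the characteristic
function. -/
lemma exists_decay (hμ : IsLevyMeasure μ) (h0 : μ ≠ 0) (hA : ConditionA μ) (a : ℝ) (N : ℕ)
    {δ : ℝ} (hδ : 0 < δ) :
    ∃ C : ℝ, ∀ t : ℝ≥0, 0 < t → ∀ s : ℝ,
      (1 + |s|) ^ N * Real.exp (-(δ * (t * ∫ u in {u : ℝ | |rho a μ t * u| ≤ 1},
        (1 - Real.cos (s * rho a μ t * u)) ∂μ))) ≤ C := by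
  obtain ⟨K, hK, hKt⟩ := mul_psiU_rho_bounds hμ h0 hA a
  obtain ⟨c, α, hc, hα, hg⟩ := exists_rpow_le_psiU hμ hA
  obtain ⟨β, hβ, hA⟩ := hA
  -- In 12β, the factor 6β comes from ψ^U ≤ 6β Re ψ and the 2 from t ψ^U(ρ_t) ≥ 1/2.
  obtain ⟨C, hC⟩ := exists_pow_mul_exp_neg_le (c := δ * c / (12 * β)) (by positivity) hα N
  -- The first entry serves |s| ≤ 1, the second |s| ≥ 1, where discarding the large jumps costs 2K
  -- in the exponent.
  refine ⟨max (2 ^ N) (2 ^ N * (C * Real.exp (δ * (2 * K)))), fun t ht s => ?_⟩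
  have ht' : (0 : ℝ) < t := ht
  set ρ := rho a μ t
  set J := ∫ u in {u : ℝ | |ρ * u| ≤ 1}, (1 - Real.cos (s * ρ * u)) ∂μ
  have hJ : 0 ≤ J := integral_nonneg fun u => by simpa using Real.cos_le_one (s * ρ * u)
  rcases le_total |s| 1 with hs | hs
  · refine le_max_of_le_left ?_
    calc _ ≤ (2 : ℝ) ^ N * 1 := by
          gcongr
          · linarith
          · rw [Real.exp_le_one_iff]; have : 0 ≤ δ * (t * J) := by positivity
            linarith
      _ = _ := mul_one _
  · refine le_max_of_le_right ?_
    have h1 := re_psi_le_setIntegral_add hμ a (s * ρ) ρ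
    have h2 : psiU μ (s * ρ) ≤ β * (6 * (psi a μ (s * ρ)).re) :=
      (hA _).trans (by gcongr; exact psiL_le_re_psi hμ a _)
    have h3 := hg ρ s hs
    obtain ⟨h4, h5⟩ := hKt t ht
    have h6 : c * |s| ^ α * (1 / 2) ≤ t * (6 * β * (psi a μ (s * ρ)).re) := by
      calc c * |s| ^ α * (1 / 2) ≤ c * |s| ^ α * (t * psiU μ ρ) := by gcongr
        _ = t * (c * |s| ^ α * psiU μ ρ) := by ring
        _ ≤ t * (6 * β * (psi a μ (s * ρ)).re) := mul_le_mul_of_nonneg_left (by linarith) ht'.le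
    have h7 : t * (psi a μ (s * ρ)).re ≤ t * J + 2 * K := by
      calc t * (psi a μ (s * ρ)).re ≤ t * (J + 2 * psiU μ ρ) := by gcongr
        _ = t * J + 2 * (t * psiU μ ρ) := by ring
        _ ≤ _ := by linarith
    have h8 : δ * c / (12 * β) * |s| ^ α ≤ δ * (t * J) + δ * (2 * K) := by
      have : c * |s| ^ α / (12 * β) ≤ t * (psi a μ (s * ρ)).re := by
        rw [div_le_iff₀ (by positivity)]; linarith
      calc δ * c / (12 * β) * |s| ^ α = δ * (c * |s| ^ α / (12 * β)) := by ring
        _ ≤ δ * (t * J + 2 * K) := by gcongr; linarith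
        _ = _ := by ring
    calc (1 + |s|) ^ N * Real.exp (-(δ * (t * J)))
        ≤ (2 * |s|) ^ N * (Real.exp (-(δ * c / (12 * β) * |s| ^ α)) * Real.exp (δ * (2 * K))) := by
          rw [← Real.exp_add]
          gcongr
          · linarith
          · linarith
      _ = 2 ^ N * ((|s| ^ N * Real.exp (-(δ * c / (12 * β) * |s| ^ α))) *
            Real.exp (δ * (2 * K))) := by rw [mul_pow]; ring
      _ ≤ _ := by gcongr; exact hC _ hs

end Levy

/-! ### Exponential decay for the compensated small jumps by contour shift. -/

section ContourShift

lemma integrable_inv_one_add_abs_sq : Integrable fun x : ℝ => ((1 + |x|) ^ 2)⁻¹ := by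
  have := integrable_one_add_norm (E := ℝ) (μ := volume) (r := 2) (by simp)
  refine this.congr (ae_of_all _ fun x => ?_)
  simp only [Real.norm_eq_abs]
  rw [Real.rpow_neg (by positivity)]
  norm_cast

lemma tendsto_inv_one_add_abs_sq : Tendsto (fun x : ℝ => ((1 + |x|) ^ 2)⁻¹) atTop (𝓝 0) := by
  refine tendsto_inv_atTop_zero.comp ((tendsto_pow_atTop two_ne_zero).comp ?_)
  exact tendsto_atTop_add_const_left _ _ tendsto_abs_atTop_atTop

/-- Horizontal shift of the contour of integration for an entire function that decays in a
strip. -/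
lemma integral_eq_integral_add_mul_I {f : ℂ → ℂ} (hf : Differentiable ℂ f) {M η : ℝ}
    (hη : |η| ≤ 1) (hM : ∀ x y : ℝ, |y| ≤ 1 → ‖f (x + y * Complex.I)‖ ≤ M * ((1 + |x|) ^ 2)⁻¹) :
    ∫ x : ℝ, f x = ∫ x : ℝ, f (x + η * Complex.I) := by
  have hint : ∀ y : ℝ, |y| ≤ 1 → Integrable fun x : ℝ => f (x + y * Complex.I) := fun y hy =>
    (integrable_inv_one_add_abs_sq.const_mul M).mono'
      (hf.continuous.comp (by fun_prop)).aestronglyMeasurable (ae_of_all _ fun x => hM x y hy)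
  have hlim : ∀ y : ℝ, |y| ≤ 1 → Tendsto (fun T : ℝ => ∫ x in -T..T, f (x + y * Complex.I))
      atTop (𝓝 (∫ x : ℝ, f (x + y * Complex.I))) := fun y hy =>
    intervalIntegral_tendsto_integral (hint y hy) tendsto_neg_atTop_atBot tendsto_id
  have hle : ∀ y ∈ Set.uIoc 0 η, |y| ≤ 1 := fun y hy => by
    rw [abs_le] at hη ⊢
    rcases Set.mem_uIoc.mp hy with h | h <;> constructor <;> linarith [h.1, h.2]
  -- The two vertical sides of the rectangle, σ = 1 and σ = -1, vanish in the limit.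
  have hvert : ∀ σ : ℝ, |σ| = 1 → Tendsto (fun T : ℝ =>
      ∫ y in (0 : ℝ)..η, f (((σ * T : ℝ) : ℂ) + y * Complex.I)) atTop (𝓝 0) := by
    intro σ hσ
    have h0 : Tendsto (fun T : ℝ => M * ((1 + |T|) ^ 2)⁻¹ * |η - 0|) atTop (𝓝 0) := by
      simpa using (tendsto_inv_one_add_abs_sq.const_mul M).mul_const |η - 0|
    refine squeeze_zero_norm (fun T => ?_) h0
    refine intervalIntegral.norm_integral_le_of_norm_le_const fun y hy => ?_
    simpa [abs_mul, hσ] using hM (σ * T) y (hle y hy)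
  have hrect : ∀ T : ℝ, (∫ x in -T..T, f (x + (0 : ℝ) * Complex.I)) =
      (∫ x in -T..T, f (x + η * Complex.I)) -
        Complex.I • (∫ y in (0 : ℝ)..η, f (((1 * T : ℝ) : ℂ) + y * Complex.I)) +
        Complex.I • (∫ y in (0 : ℝ)..η, f (((-1 * T : ℝ) : ℂ) + y * Complex.I)) := by
    intro T
    have := Complex.integral_boundary_rect_eq_zero_of_differentiableOn f ⟨-T, 0⟩ ⟨T, η⟩
      hf.differentiableOn
    simp only at this
    rw [one_mul, neg_one_mul]
    linear_combination this
  have h1 := hlim 0 (by simp)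
  have h2 := ((hlim η hη).sub ((hvert 1 (by simp)).const_smul Complex.I)).add
    ((hvert (-1) (by simp)).const_smul Complex.I)
  simp_rw [hrect] at h1
  have := tendsto_nhds_unique h1 h2
  simpa using this

/-- The exponent `z ↦ ∫ (1 - e^{izv} + izv) ν(dv)` of the fully compensated jumps with intensity
`ν`. -/
def compExponent (ν : Measure ℝ) (z : ℂ) : ℂ :=
  ∫ v : ℝ, (1 - Complex.exp (Complex.I * z * v) + Complex.I * z * v) ∂ν

variable {ν : Measure ℝ}

lemma integrable_compExponent (hν : ∀ᵐ v ∂ν, |v| ≤ 1) (h2 : Integrable (fun v : ℝ => v ^ 2) ν)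
    (z : ℂ) : Integrable (fun v : ℝ => 1 - Complex.exp (Complex.I * z * v) + Complex.I * z * v) ν := by
  refine (h2.const_mul (‖z‖ ^ 2 * Real.exp ‖z‖)).mono' (by fun_prop) ?_
  filter_upwards [hν] with v hv
  refine (norm_one_sub_exp_add_le _).trans ?_
  have hn : ‖Complex.I * z * v‖ = ‖z‖ * |v| := by simp
  rw [hn]
  have : ‖z‖ * |v| ≤ ‖z‖ := mul_le_of_le_one_right (norm_nonneg z) hv
  calc (‖z‖ * |v|) ^ 2 * Real.exp (‖z‖ * |v|) ≤ (‖z‖ * |v|) ^ 2 * Real.exp ‖z‖ := by gcongr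
    _ = _ := by rw [mul_pow, sq_abs]; ring

/-- Jumps bounded by 1 make the exponent entire: the z-derivative of the integrand is O(v²), locally
uniformly in z. -/
lemma differentiable_compExponent (hν : ∀ᵐ v ∂ν, |v| ≤ 1)
    (h2 : Integrable (fun v : ℝ => v ^ 2) ν) : Differentiable ℂ (compExponent ν) := by
  intro z₀
  refine (hasDerivAt_integral_of_dominated_loc_of_deriv_le (μ := ν) (𝕜 := ℂ)
    (F := fun z v => 1 - Complex.exp (Complex.I * z * v) + Complex.I * z * v)
    (F' := fun z v => (1 - Complex.exp (Complex.I * z * v)) * (Complex.I * v))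
    (bound := fun v => ((‖z₀‖ + 1) * Real.exp (‖z₀‖ + 1)) * v ^ 2)
    (Metric.ball_mem_nhds z₀ one_pos) (Eventually.of_forall fun z => by fun_prop)
    (integrable_compExponent hν h2 z₀) (by fun_prop) ?_ (h2.const_mul _) ?_).2.differentiableAt
  · filter_upwards [hν] with v hv z hz
    have hz' : ‖z‖ ≤ ‖z₀‖ + 1 := by
      have := norm_sub_norm_le z z₀
      rw [Metric.mem_ball, dist_eq_norm] at hz; linarith
    have h1 := Complex.norm_exp_sub_sum_le_norm_mul_exp (Complex.I * z * v) 1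
    simp only [Finset.sum_range_one, pow_zero, Nat.factorial_zero, Nat.cast_one, div_one,
      pow_one] at h1
    rw [norm_sub_rev] at h1
    have hn : ‖Complex.I * z * v‖ = ‖z‖ * |v| := by simp
    rw [hn] at h1
    have h3 : ‖z‖ * |v| ≤ ‖z₀‖ + 1 := (mul_le_of_le_one_right (norm_nonneg z) hv).trans hz'
    rw [norm_mul]
    have hn2 : ‖Complex.I * (v : ℂ)‖ = |v| := by simp
    rw [hn2]
    calc _ ≤ ‖z‖ * |v| * Real.exp (‖z‖ * |v|) * |v| := by gcongr
      _ ≤ (‖z₀‖ + 1) * |v| * Real.exp (‖z₀‖ + 1) * |v| := by gcongr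
      _ = _ := by rw [← sq_abs v]; ring
  · refine ae_of_all _ fun v z _ => ?_
    have h1 : HasDerivAt (fun z : ℂ => Complex.I * z * v) (Complex.I * v) z := by
      simpa using ((hasDerivAt_id z).const_mul Complex.I).mul_const (v : ℂ)
    exact ((h1.cexp.const_sub 1).add h1).congr_deriv (by ring)

/-- The real part equals e^{-ηv}(1 - cos sv) plus the Taylor remainder 1 - e^{-ηv} - ηv. As |ηv| ≤
1, the first term keeps a factor e^{-1} and the second is at most 3v² in absolute value, because e <
3. So leaving the real line costs a constant factor in the decay and a multiple of the second
moment. -/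
lemma exp_neg_one_mul_one_sub_cos_sub_le {η v : ℝ} (hη : |η| ≤ 1) (hv : |v| ≤ 1) (s : ℝ) :
    Real.exp (-1) * (1 - Real.cos (s * v)) - 3 * v ^ 2 ≤
      (1 - Complex.exp (Complex.I * (s + η * Complex.I) * v) +
        Complex.I * (s + η * Complex.I) * v).re := by
  have e : Complex.I * (s + η * Complex.I) * v = ((-(η * v) : ℝ) : ℂ) + ((s * v : ℝ) : ℂ) * Complex.I := by
    push_cast; linear_combination (η * v : ℂ) * Complex.I_mul_I
  have hle : |η * v| ≤ 1 := by
    rw [abs_mul]; exact mul_le_one₀ hη (abs_nonneg v) hv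
  have hre : (1 - Complex.exp (Complex.I * (s + η * Complex.I) * v) +
      Complex.I * (s + η * Complex.I) * v).re =
      Real.exp (-(η * v)) * (1 - Real.cos (s * v)) + (1 - Real.exp (-(η * v)) + -(η * v)) := by
    rw [e, Complex.add_re, Complex.sub_re, Complex.exp_re]
    simp
    ring
  have h1 := norm_one_sub_exp_add_le ((-(η * v) : ℝ) : ℂ)
  have h2 : ‖1 - Complex.exp ((-(η * v) : ℝ) : ℂ) + ((-(η * v) : ℝ) : ℂ)‖ =
      |1 - Real.exp (-(η * v)) + -(η * v)| := by
    rw [← Real.norm_eq_abs, ← Complex.norm_real]; push_cast; rfl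
  have hn : ‖((-(η * v) : ℝ) : ℂ)‖ = |η * v| := by
    rw [Complex.norm_real, Real.norm_eq_abs, abs_neg]
  rw [h2, hn] at h1
  have h3 : Real.exp |η * v| ≤ 3 :=
    (Real.exp_le_exp.mpr hle).trans (by linarith [Real.exp_one_lt_d9])
  have h4 : |η * v| ^ 2 ≤ v ^ 2 := by
    rw [sq_abs, mul_pow]
    have : η ^ 2 ≤ 1 := by rw [← sq_abs]; nlinarith [abs_nonneg η]
    nlinarith [sq_nonneg v]
  have h5 : |1 - Real.exp (-(η * v)) + -(η * v)| ≤ 3 * v ^ 2 := by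
    calc _ ≤ |η * v| ^ 2 * Real.exp |η * v| := h1
      _ ≤ v ^ 2 * 3 := by gcongr
      _ = _ := by ring
  have h6 : Real.exp (-1) * (1 - Real.cos (s * v)) ≤
      Real.exp (-(η * v)) * (1 - Real.cos (s * v)) := by
    have : 0 ≤ 1 - Real.cos (s * v) := by linarith [Real.cos_le_one (s * v)]
    gcongr
    linarith [(abs_le.mp hle).2]
  rw [hre]
  linarith [(abs_le.mp h5).1]

lemma integrable_one_sub_cos_mul (h2 : Integrable (fun v : ℝ => v ^ 2) ν) (s : ℝ) :
    Integrable (fun v : ℝ => 1 - Real.cos (s * v)) ν := by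
  refine (h2.const_mul (2 * s ^ 2)).mono' (by fun_prop) (ae_of_all _ fun v => ?_)
  rw [Real.norm_of_nonneg (by linarith [Real.cos_le_one (s * v)])]
  refine (one_sub_cos_le _).trans ?_
  have := min_le_left ((s * v) ^ 2) 1
  nlinarith

lemma norm_exp_neg_compExponent_le (hν : ∀ᵐ v ∂ν, |v| ≤ 1)
    (h2 : Integrable (fun v : ℝ => v ^ 2) ν) {K : ℝ} (hK : ∫ v, v ^ 2 ∂ν ≤ K) {η : ℝ}
    (hη : |η| ≤ 1) (s : ℝ) :
    ‖Complex.exp (-compExponent ν (s + η * Complex.I))‖ ≤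
      Real.exp (3 * K) * Real.exp (-(Real.exp (-1) * ∫ v, (1 - Real.cos (s * v)) ∂ν)) := by
  rw [Complex.norm_exp, ← Real.exp_add, Real.exp_le_exp, Complex.neg_re]
  have h := integral_re (integrable_compExponent hν h2 (s + η * Complex.I))
  simp only [RCLike.re_eq_complex_re] at h
  rw [compExponent, ← h]
  have hc := integrable_one_sub_cos_mul h2 s
  have : Real.exp (-1) * (∫ v, (1 - Real.cos (s * v)) ∂ν) - 3 * ∫ v, v ^ 2 ∂ν ≤
      ∫ v : ℝ, (1 - Complex.exp (Complex.I * (s + η * Complex.I) * v) +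
        Complex.I * (s + η * Complex.I) * v).re ∂ν := by
    rw [← integral_const_mul, ← integral_const_mul, ← integral_sub (hc.const_mul _) (h2.const_mul _)]
    refine integral_mono_ae ((hc.const_mul _).sub (h2.const_mul _))
      (integrable_compExponent hν h2 _).re ?_
    filter_upwards [hν] with v hv
    exact exp_neg_one_mul_one_sub_cos_sub_le hη hv s
  linarith

/-- Of the k + 2 powers in the decay hypothesis, k absorb the differentiation factor and 2 leave an
integrable majorant. -/
lemma norm_pow_mul_exp_neg_compExponent_le (hν : ∀ᵐ v ∂ν, |v| ≤ 1)
    (h2 : Integrable (fun v : ℝ => v ^ 2) ν) {K : ℝ} (hK : ∫ v, v ^ 2 ∂ν ≤ K) {k : ℕ} {C : ℝ}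
    (hC : ∀ s : ℝ, (1 + |s|) ^ (k + 2) *
      Real.exp (-(Real.exp (-1) * ∫ v, (1 - Real.cos (s * v)) ∂ν)) ≤ C) {η : ℝ}
    (hη : |η| ≤ 1) (s : ℝ) :
    ‖(-Complex.I * (s + η * Complex.I)) ^ k * Complex.exp (-compExponent ν (s + η * Complex.I))‖ ≤
      C * Real.exp (3 * K) * ((1 + |s|) ^ 2)⁻¹ := by
  rw [norm_mul, norm_pow]
  have h1 : ‖-Complex.I * (s + η * Complex.I)‖ ≤ 1 + |s| := by
    rw [norm_mul, norm_neg, Complex.norm_I, one_mul]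
    refine (norm_add_le _ _).trans ?_
    rw [norm_mul, Complex.norm_I, mul_one, Complex.norm_real, Complex.norm_real, Real.norm_eq_abs,
      Real.norm_eq_abs]
    linarith
  rw [← div_eq_mul_inv, le_div_iff₀ (by positivity)]
  calc _ ≤ (1 + |s|) ^ k * (Real.exp (3 * K) *
        Real.exp (-(Real.exp (-1) * ∫ v, (1 - Real.cos (s * v)) ∂ν))) * (1 + |s|) ^ 2 := by
        gcongr
        exact norm_exp_neg_compExponent_le hν h2 hK hη s
    _ = ((1 + |s|) ^ (k + 2) * Real.exp (-(Real.exp (-1) * ∫ v, (1 - Real.cos (s * v)) ∂ν))) *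
        Real.exp (3 * K) := by ring
    _ ≤ C * Real.exp (3 * K) := by gcongr; exact hC s

lemma integrable_pow_mul_exp_neg_compExponent (hν : ∀ᵐ v ∂ν, |v| ≤ 1)
    (h2 : Integrable (fun v : ℝ => v ^ 2) ν) {K : ℝ} (hK : ∫ v, v ^ 2 ∂ν ≤ K) {k : ℕ} {C : ℝ}
    (hC : ∀ s : ℝ, (1 + |s|) ^ (k + 2) *
      Real.exp (-(Real.exp (-1) * ∫ v, (1 - Real.cos (s * v)) ∂ν)) ≤ C) :
    Integrable fun s : ℝ => (-Complex.I * s) ^ k * Complex.exp (-compExponent ν s) := by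
  have hd := (differentiable_compExponent hν h2).continuous
  refine (integrable_inv_one_add_abs_sq.const_mul (C * Real.exp (3 * K))).mono'
    (Continuous.aestronglyMeasurable (by fun_prop)) (ae_of_all _ fun s => ?_)
  simpa using norm_pow_mul_exp_neg_compExponent_le hν h2 hK hC (η := 0) (by simp) s

/-- Exponential decay of the derivatives of the density of the compensated small jumps. -/
lemma norm_integral_exp_compExponent_le (hν : ∀ᵐ v ∂ν, |v| ≤ 1)
    (h2 : Integrable (fun v : ℝ => v ^ 2) ν) {K : ℝ} (hK : ∫ v, v ^ 2 ∂ν ≤ K) {k : ℕ} {C : ℝ}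
    (hC : ∀ s : ℝ, (1 + |s|) ^ (k + 2) *
      Real.exp (-(Real.exp (-1) * ∫ v, (1 - Real.cos (s * v)) ∂ν)) ≤ C) (x : ℝ) :
    ‖∫ s : ℝ, (-Complex.I * s) ^ k * Complex.exp (-compExponent ν s) *
        Complex.exp (-Complex.I * s * x)‖ ≤
      C * Real.exp (3 * K) * (∫ s : ℝ, ((1 + |s|) ^ 2)⁻¹) * Real.exp (-|x|) := by
  set f : ℂ → ℂ := fun z => (-Complex.I * z) ^ k * Complex.exp (-compExponent ν z) *
    Complex.exp (-Complex.I * z * x) with hf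
  have hd : Differentiable ℂ f := by
    have := differentiable_compExponent hν h2
    fun_prop
  have hb : ∀ s η : ℝ, |η| ≤ 1 → ‖f (s + η * Complex.I)‖ ≤
      C * Real.exp (3 * K) * Real.exp (η * x) * ((1 + |s|) ^ 2)⁻¹ := by
    intro s η hη
    rw [hf, norm_mul]
    have : ‖Complex.exp (-Complex.I * (s + η * Complex.I) * x)‖ = Real.exp (η * x) := by
      rw [Complex.norm_exp]; congr 1; simp
    rw [this]
    calc _ ≤ C * Real.exp (3 * K) * ((1 + |s|) ^ 2)⁻¹ * Real.exp (η * x) := by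
          gcongr; exact norm_pow_mul_exp_neg_compExponent_le hν h2 hK hC hη s
      _ = _ := by ring
  have hC0 : 0 ≤ C := le_trans (by positivity) (hC 0)
  -- The contour moves to the side where the Fourier kernel has modulus e^{-|x|}.
  obtain ⟨η, hη, hηx⟩ : ∃ η : ℝ, |η| ≤ 1 ∧ η * x = -|x| := by
    rcases le_total 0 x with h | h
    · exact ⟨-1, by simp, by rw [abs_of_nonneg h]; ring⟩
    · exact ⟨1, by simp, by rw [abs_of_nonpos h]; ring⟩
  -- The crude factor e^{|x|} only justifies the shift; the sharp factor is used on the target line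
  -- alone.
  have hshift := integral_eq_integral_add_mul_I hd (M := C * Real.exp (3 * K) * Real.exp |x|) hη
    fun s y hy => (hb s y hy).trans (by
      gcongr
      calc y * x ≤ |y * x| := le_abs_self _
        _ = |y| * |x| := abs_mul _ _
        _ ≤ |x| := mul_le_of_le_one_left (abs_nonneg x) hy)
  change ‖∫ s : ℝ, f s‖ ≤ _
  rw [hshift]
  calc ‖∫ s : ℝ, f (s + η * Complex.I)‖
      ≤ ∫ s : ℝ, C * Real.exp (3 * K) * Real.exp (η * x) * ((1 + |s|) ^ 2)⁻¹ :=
        norm_integral_le_of_norm_le (integrable_inv_one_add_abs_sq.const_mul _)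
          (ae_of_all _ fun s => hb s η hη)
    _ = _ := by rw [integral_const_mul, hηx]; ring

end ContourShift

/-! ### Smooth densities by Fourier inversion. -/

section Inversion

open scoped FourierTransform SchwartzMap

variable (ν : Measure ℝ)

/-- The characteristic function in the normalization of the Fourier transform `𝓕`. -/
def scaledCharFun (w : ℝ) : ℂ := charFun ν (2 * Real.pi * w)

/-- The inverse Fourier transform of the characteristic function of `ν`. -/
def inversionDensity (x : ℝ) : ℝ := (𝓕 (scaledCharFun ν) x).re

variable {ν}

/-- Hermitian symmetry of the characteristic function makes its transform real. -/
lemma fourier_scaledCharFun_eq (x : ℝ) :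
    𝓕 (scaledCharFun ν) x = (inversionDensity ν x : ℂ) := by
  refine (Complex.conj_eq_iff_re.mp ?_).symm
  rw [Real.fourier_real_eq_integral_exp_smul, ← integral_conj,
    ← integral_neg_eq_self (fun v => Complex.exp (↑(-2 * Real.pi * v * x) * Complex.I) •
      scaledCharFun ν v)]
  refine integral_congr_ae (ae_of_all _ fun v => ?_)
  simp only [smul_eq_mul, map_mul, scaledCharFun, ← charFun_neg, ← Complex.exp_conj,
    Complex.conj_ofReal, Complex.conj_I]
  congr 2
  · push_cast; ring
  · ring

lemma continuous_inversionDensity (hν : Integrable (scaledCharFun ν)) :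
    Continuous (inversionDensity ν) :=
  Complex.continuous_re.comp (VectorFourier.fourierIntegral_continuous
    Real.continuous_fourierChar continuous_inner hν)

variable [IsProbabilityMeasure ν]

/-- Parseval: writing f as the inverse transform of 𝓕 f turns the left side into ∫ 𝓕 f · φ, and
self-adjointness of 𝓕 moves the transform onto φ. The density is thus identified weakly before its
sign or integrability is known. -/
lemma integral_schwartz_eq (hν : Integrable (scaledCharFun ν)) (f : 𝓢(ℝ, ℂ)) :
    ∫ x, f x ∂ν = ∫ x, f x * inversionDensity ν x := by
  have hL : Continuous fun p : ℝ × ℝ => innerₗ ℝ p.1 p.2 := continuous_inner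
  have hL' : Continuous fun p : ℝ × ℝ => (-innerₗ ℝ) p.1 p.2 := continuous_inner.neg
  have hFf : Integrable (𝓕 (f : ℝ → ℂ)) := by
    rw [← SchwartzMap.fourier_coe]; exact (𝓕 f).integrable
  have h1 := VectorFourier.integral_fourierIntegral_smul_eq_flip (μ := volume) (ν := ν)
    (f := 𝓕 (f : ℝ → ℂ)) (g := fun _ : ℝ => (1 : ℂ)) Real.continuous_fourierChar hL' hFf
    (integrable_const 1)
  have h2 := VectorFourier.integral_fourierIntegral_smul_eq_flip (μ := volume) (ν := volume)
    (f := (f : ℝ → ℂ)) (g := scaledCharFun ν) Real.continuous_fourierChar hL f.integrable hν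
  have e1 : ∀ x, VectorFourier.fourierIntegral Real.fourierChar volume (-innerₗ ℝ)
      (𝓕 (f : ℝ → ℂ)) x = f x := by
    intro x
    rw [← congr_fun (f.continuous.fourierInv_fourier_eq f.integrable hFf) x, Real.fourierInv_eq]
    simp [VectorFourier.fourierIntegral]
  have e2 : ∀ x, VectorFourier.fourierIntegral Real.fourierChar ν (-innerₗ ℝ).flip
      (fun _ : ℝ => (1 : ℂ)) x = scaledCharFun ν x := by
    intro x
    rw [scaledCharFun, charFun_apply_real]
    refine integral_congr_ae (ae_of_all _ fun y => ?_)
    simp only [Circle.smul_def, Real.fourierChar_apply, smul_eq_mul, mul_one]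
    congr 1
    simp
    ring
  simp only [e1, e2, smul_eq_mul, mul_one] at h1
  rw [h1]
  simp only [smul_eq_mul] at h2
  have e3 : ∀ x, VectorFourier.fourierIntegral Real.fourierChar volume (innerₗ ℝ) (f : ℝ → ℂ) x =
      𝓕 (f : ℝ → ℂ) x := fun x => rfl
  have e4 : ∀ x, VectorFourier.fourierIntegral Real.fourierChar volume (innerₗ ℝ).flip
      (scaledCharFun ν) x = inversionDensity ν x := fun x => by
    rw [← fourier_scaledCharFun_eq, flip_innerₗ]; rfl
  simp only [e3, e4] at h2
  exact h2

lemma integral_bump_eq (hν : Integrable (scaledCharFun ν)) {c : ℝ} (f : ContDiffBump c) :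
    ∫ x, f x ∂ν = ∫ x, f x * inversionDensity ν x := by
  have hc : HasCompactSupport fun x => (f x : ℂ) := 
    f.hasCompactSupport.comp_left (g := ((↑) : ℝ → ℂ)) Complex.ofReal_zero
  have hd : ContDiff ℝ ((⊤ : ℕ∞) : WithTop ℕ∞) fun x => (f x : ℂ) :=
    Complex.ofRealCLM.contDiff.comp f.contDiff
  have := integral_schwartz_eq hν (hc.toSchwartzMap hd)
  simp only [HasCompactSupport.toSchwartzMap_toFun] at this
  exact_mod_cast this

/-- Near a point of negativity a bump would have a negative integral against the density, yet a
nonnegative one against ν. -/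
lemma inversionDensity_nonneg (hν : Integrable (scaledCharFun ν)) (x : ℝ) :
    0 ≤ inversionDensity ν x := by
  by_contra! hx
  have hcont := continuous_inversionDensity hν
  obtain ⟨ε, hε, hball⟩ := Metric.mem_nhds_iff.mp
    (hcont.continuousAt.eventually_lt continuousAt_const hx)
  let f : ContDiffBump x := ⟨ε / 2, ε, by linarith, by linarith⟩
  have h1 : 0 ≤ ∫ y, f y ∂ν := integral_nonneg fun y => f.nonneg
  have hle : ∀ y, 0 ≤ -(f y * inversionDensity ν y) := by
    intro y
    by_cases hy : y ∈ Metric.ball x ε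
    · have : inversionDensity ν y < 0 := hball hy
      nlinarith [f.nonneg' y]
    · rw [f.zero_of_le_dist (by simpa using hy)]; simp
  have hcont2 : Continuous fun y => -(f y * inversionDensity ν y) := (f.continuous.mul hcont).neg
  have h2 : 0 < ∫ y, -(f y * inversionDensity ν y) := by
    refine hcont2.integral_pos_of_hasCompactSupport_nonneg_nonzero ?_ hle (x := x) ?_
    · exact f.hasCompactSupport.mul_right.neg
    · rw [f.one_of_mem_closedBall (Metric.mem_closedBall_self (by positivity : (0 : ℝ) ≤ ε / 2))]
      simpa using hx.ne
  rw [integral_neg, ← integral_bump_eq hν f] at h2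
  linarith

/-- Bumps equal to 1 on growing balls bound the mass of the density there by ν(ℝ) = 1. -/
lemma integrable_inversionDensity (hν : Integrable (scaledCharFun ν)) :
    Integrable (inversionDensity ν) := by
  have hcont := continuous_inversionDensity hν
  refine (aecover_closedBall (x := (0 : ℝ)) (l := atTop) (r := fun n : ℕ => (n : ℝ) + 1)
    (tendsto_natCast_atTop_atTop.atTop_add tendsto_const_nhds)).integrable_of_integral_norm_bounded
    1 (fun n => hcont.continuousOn.integrableOn_compact (isCompact_closedBall _ _))
    (Eventually.of_forall fun n => ?_)
  let f : ContDiffBump (0 : ℝ) := ⟨(n : ℝ) + 1, n + 2, by positivity, by linarith⟩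
  have hint : Integrable fun y => f y * inversionDensity ν y :=
    (f.continuous.mul hcont).integrable_of_hasCompactSupport f.hasCompactSupport.mul_right
  have h1 : ∫ y, f y ∂ν ≤ ∫ _, (1 : ℝ) ∂ν :=
    integral_mono_of_nonneg (ae_of_all _ fun y => f.nonneg) (integrable_const 1)
      (ae_of_all _ fun y => f.le_one)
  rw [integral_bump_eq hν f] at h1
  simp only [integral_const, probReal_univ, smul_eq_mul, mul_one] at h1
  refine le_trans ?_ h1
  calc ∫ y in Metric.closedBall 0 ((n : ℝ) + 1), ‖inversionDensity ν y‖
      = ∫ y in Metric.closedBall 0 ((n : ℝ) + 1), f y * inversionDensity ν y := by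
        refine setIntegral_congr_fun Metric.isClosed_closedBall.measurableSet fun y hy => ?_
        rw [f.one_of_mem_closedBall hy, one_mul, Real.norm_of_nonneg (inversionDensity_nonneg hν y)]
    _ ≤ ∫ y, f y * inversionDensity ν y := setIntegral_le_integral hint
        (ae_of_all _ fun y => mul_nonneg f.nonneg (inversionDensity_nonneg hν y))

lemma continuous_scaledCharFun : Continuous (scaledCharFun ν) :=
  continuous_charFun.comp (by fun_prop)

/-- Once the density is known to be integrable, Fourier inversion shows that both measures have the
same characteristic function. -/
lemma eq_withDensity_inversionDensity (hν : Integrable (scaledCharFun ν)) :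
    ν = volume.withDensity fun x => ENNReal.ofReal (inversionDensity ν x) := by
  have hi := integrable_inversionDensity hν
  have : IsFiniteMeasure (volume.withDensity fun x => ENNReal.ofReal (inversionDensity ν x)) :=
    isFiniteMeasure_withDensity_ofReal hi.2
  refine Measure.ext_of_charFun (funext fun s => ?_)
  have hm : Measurable fun x => ENNReal.ofReal (inversionDensity ν x) :=
    (continuous_inversionDensity hν).measurable.ennreal_ofReal
  have hF : 𝓕 (scaledCharFun ν) = fun x => (inversionDensity ν x : ℂ) :=
    funext fourier_scaledCharFun_eq
  have hinv := congr_fun (continuous_scaledCharFun.fourierInv_fourier_eq hν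
    (by rw [hF]; exact hi.ofReal)) (s / (2 * Real.pi))
  have hs : 2 * Real.pi * (s / (2 * Real.pi)) = s := by field_simp
  rw [scaledCharFun, hs] at hinv
  rw [← hinv, charFun_apply_real, integral_withDensity_eq_integral_toReal_smul hm
    (ae_of_all _ fun _ => ENNReal.ofReal_lt_top), hF, Real.fourierInv_eq']
  refine integral_congr_ae (ae_of_all _ fun y => ?_)
  simp only [ENNReal.toReal_ofReal (inversionDensity_nonneg hν y), Complex.real_smul, smul_eq_mul]
  rw [mul_comm]
  congr 2
  simp only [RCLike.inner_apply, conj_trivial]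
  push_cast
  field_simp

/-- A probability measure with rapidly decreasing characteristic function has a smooth density. -/
lemma isSmoothDensity_inversionDensity
    (hν : ∀ n : ℕ, Integrable fun w : ℝ => w ^ n • scaledCharFun ν w) :
    IsSmoothDensity ν (inversionDensity ν) := by
  have h0 : Integrable (scaledCharFun ν) := by simpa using hν 0
  refine ⟨?_, inversionDensity_nonneg h0, eq_withDensity_inversionDensity h0⟩
  refine Complex.reCLM.contDiff.comp (Real.contDiff_fourier fun n _ => ?_)
  convert! (hν n).norm using 2 with w
  simp

lemma abs_iteratedDeriv_inversionDensity_le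
    (hν : ∀ n : ℕ, Integrable fun w : ℝ => w ^ n • scaledCharFun ν w) (k : ℕ) (x : ℝ) :
    |iteratedDeriv k (inversionDensity ν) x| ≤
      ‖∫ w : ℝ, (-2 * Real.pi * Complex.I * w) ^ k * scaledCharFun ν w *
        Complex.exp (-2 * Real.pi * Complex.I * w * x)‖ := by
  have hd : ContDiff ℝ ((⊤ : ℕ∞) : WithTop ℕ∞) (inversionDensity ν) :=
    (isSmoothDensity_inversionDensity hν).1
  have h1 := congr_fun (Real.iteratedDeriv_fourier (N := ⊤) (n := k) (fun n _ => hν n) le_top) x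
  have hF : 𝓕 (scaledCharFun ν) = Complex.ofRealCLM ∘ inversionDensity ν :=
    funext fourier_scaledCharFun_eq
  rw [hF] at h1
  have h2 : ‖iteratedDeriv k (Complex.ofRealCLM ∘ inversionDensity ν) x‖ =
      |iteratedDeriv k (inversionDensity ν) x| := by
    rw [← Real.norm_eq_abs, ← norm_iteratedFDeriv_eq_norm_iteratedDeriv,
      ← norm_iteratedFDeriv_eq_norm_iteratedDeriv]
    exact Complex.ofRealLI.norm_iteratedFDeriv_comp_left (hd.contDiffAt) (by exact_mod_cast le_top)
  rw [← h2, h1, Real.fourier_real_eq_integral_exp_smul]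
  refine le_of_eq (congrArg _ (integral_congr_ae (ae_of_all _ fun w => ?_)))
  simp only [smul_eq_mul]
  rw [mul_comm]
  congr 2
  push_cast
  ring

end Inversion

/-! ### Expansion of the compound Poisson factor. -/

section CompoundExpansion

variable (Q : Measure ℝ) [IsFiniteMeasure Q]

lemma isFiniteMeasure_convPow (m : ℕ) : IsFiniteMeasure (convPow Q m) := by
  induction m with
  | zero => unfold convPow; infer_instance
  | succ m ih => unfold convPow; infer_instance

lemma charFun_convPow (m : ℕ) (ξ : ℝ) : charFun (convPow Q m) ξ = charFun Q ξ ^ m := by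
  induction m with
  | zero => simp [convPow, charFun_dirac]
  | succ m ih =>
    have := isFiniteMeasure_convPow Q m
    rw [convPow, charFun_conv, ih, pow_succ]

lemma convPow_real_univ (m : ℕ) : (convPow Q m).real Set.univ = Q.real Set.univ ^ m := by
  have h := charFun_convPow Q m 0
  rw [charFun_zero, charFun_zero] at h
  exact_mod_cast h

variable {Q}

lemma integrable_convPow {H : ℝ → ℝ} (hH : Measurable H) {B : ℝ} (hB : ∀ y, |H y| ≤ B) (m : ℕ) :
    Integrable H (convPow Q m) := by
  have := isFiniteMeasure_convPow Q m
  exact (integrable_const B).mono' hH.aestronglyMeasurable (ae_of_all _ hB)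

lemma summable_convPow {H : ℝ → ℝ} {B : ℝ} (hB : ∀ y, |H y| ≤ B) :
    Summable fun m : ℕ => 1 / (m.factorial : ℝ) * ∫ y, H y ∂(convPow Q m) := by
  refine Summable.of_norm_bounded ((Real.summable_pow_div_factorial (Q.real Set.univ)).mul_left B)
    fun m => ?_
  have := isFiniteMeasure_convPow Q m
  have h := norm_integral_le_of_norm_le_const (μ := convPow Q m) (f := H) (C := B)
    (ae_of_all _ hB)
  rw [convPow_real_univ] at h
  rw [norm_mul, Real.norm_of_nonneg (by positivity)]
  calc 1 / (m.factorial : ℝ) * ‖∫ y, H y ∂(convPow Q m)‖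
      ≤ 1 / (m.factorial : ℝ) * (B * Q.real Set.univ ^ m) := by gcongr
    _ = _ := by ring

/-- Fubini: a factor `charFun κ` on the Fourier side averages translates over κ. -/
lemma integral_mul_charFun_mul_exp {W : ℝ → ℂ} (hW : Integrable W) (κ : Measure ℝ)
    [IsFiniteMeasure κ] (r x : ℝ) :
    ∫ s : ℝ, W s * charFun κ (r * s) * Complex.exp (-Complex.I * s * (r * x : ℝ)) =
      ∫ y, (∫ s : ℝ, W s * Complex.exp (-Complex.I * s * (r * (x - y) : ℝ))) ∂κ := by
  rw [integral_integral_swap]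
  · refine integral_congr_ae (ae_of_all _ fun s => ?_)
    simp only
    rw [integral_const_mul, charFun_apply_real, mul_assoc, ← integral_mul_const]
    congr 1
    refine integral_congr_ae (ae_of_all _ fun y => ?_)
    simp only [← Complex.exp_add]
    congr 1
    push_cast
    ring
  · have h : Integrable (fun p : ℝ × ℝ => W p.2) (κ.prod volume) := hW.comp_snd κ
    refine h.norm.mono' (h.aestronglyMeasurable.mul (by fun_prop)) (ae_of_all _ fun p => ?_)
    simp only [Function.uncurry]
    rw [norm_mul]
    have : ‖Complex.exp (-Complex.I * p.2 * (r * (x - p.1) : ℝ))‖ = 1 := by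
      rw [Complex.norm_exp]; simp
    rw [this, mul_one]

/-- Compound expansion: multiplication by the compound Poisson factor on the Fourier side. -/
lemma norm_integral_mul_exp_charFun_le {W : ℝ → ℂ} (hW : Integrable W) {F : ℝ → ℝ}
    (hF : Measurable F) {B : ℝ} (hB : ∀ y, |F y| ≤ B)
    (hG : ∀ x : ℝ, ‖∫ s : ℝ, W s * Complex.exp (-Complex.I * s * x)‖ ≤ F x) (r x : ℝ) :
    ‖∫ s : ℝ, W s * Complex.exp (charFun Q (r * s)) *
        Complex.exp (-Complex.I * s * (r * x : ℝ))‖ ≤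
      ∑' m : ℕ, 1 / (m.factorial : ℝ) * ∫ y, F (r * (x - y)) ∂(convPow Q m) := by
  set T : ℕ → ℝ → ℂ := fun m s => 1 / (m.factorial : ℂ) *
    (W s * charFun (convPow Q m) (r * s) * Complex.exp (-Complex.I * s * (r * x : ℝ))) with hT
  have hexp : ∀ s : ℝ, ‖Complex.exp (-Complex.I * s * (r * x : ℝ))‖ = 1 := fun s => by
    rw [Complex.norm_exp]; simp
  have hTn : ∀ m s, ‖T m s‖ ≤ Q.real Set.univ ^ m / m.factorial * ‖W s‖ := by
    intro m s
    have := isFiniteMeasure_convPow Q m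
    have h1 : ‖charFun (convPow Q m) (r * s)‖ ≤ Q.real Set.univ ^ m := by
      rw [← convPow_real_univ]; exact norm_charFun_le _
    simp only [hT, norm_mul, hexp, norm_div, norm_one, mul_one, Complex.norm_natCast]
    calc 1 / (m.factorial : ℝ) * (‖W s‖ * ‖charFun (convPow Q m) (r * s)‖)
        ≤ 1 / (m.factorial : ℝ) * (‖W s‖ * Q.real Set.univ ^ m) := by gcongr
      _ = _ := by ring
  have hTi : ∀ m, Integrable (T m) := by
    intro m
    have := isFiniteMeasure_convPow Q m
    have hc : Continuous fun s => charFun (convPow Q m) (r * s) :=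
      continuous_charFun.comp (by fun_prop)
    refine (hW.norm.const_mul _).mono' ?_ (ae_of_all _ (hTn m))
    exact ((hW.aestronglyMeasurable.mul hc.aestronglyMeasurable).mul
      (by fun_prop)).const_mul _
  -- Dominated by the exponential series of the total mass of Q; this licenses exchanging sum and
  -- integral.
  have hsum : Summable fun m => ∫ s, ‖T m s‖ := by
    refine Summable.of_nonneg_of_le (fun m => integral_nonneg fun s => norm_nonneg _) (fun m => ?_)
      ((Real.summable_pow_div_factorial (Q.real Set.univ)).mul_right (∫ s, ‖W s‖))
    rw [← integral_const_mul]
    exact integral_mono (hTi m).norm (hW.norm.const_mul _) (hTn m)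
  have hkey := (hasSum_integral_of_summable_integral_norm hTi hsum).tsum_eq
  have hpt : ∀ s, ∑' m, T m s = W s * Complex.exp (charFun Q (r * s)) *
      Complex.exp (-Complex.I * s * (r * x : ℝ)) := by
    intro s
    have h := (NormedSpace.expSeries_div_hasSum_exp (charFun Q (r * s)))
    rw [← Complex.exp_eq_exp_ℂ] at h
    rw [← ((h.mul_left (W s)).mul_right (Complex.exp (-Complex.I * s * (r * x : ℝ)))).tsum_eq]
    refine tsum_congr fun m => ?_
    simp only [hT, charFun_convPow]
    ring
  simp_rw [hpt] at hkey
  rw [← hkey]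
  refine tsum_of_norm_bounded (summable_convPow (H := fun y => F (r * (x - y)))
    fun y => hB _).hasSum fun m => ?_
  have := isFiniteMeasure_convPow Q m
  simp only [hT]
  rw [integral_const_mul, integral_mul_charFun_mul_exp hW, norm_mul]
  have h1 : ‖(1 / (m.factorial : ℂ))‖ = 1 / (m.factorial : ℝ) := by simp
  rw [h1]
  gcongr
  exact norm_integral_le_of_norm_le
    (integrable_convPow (H := fun y => F (r * (x - y))) (by fun_prop) (fun y => hB _) m) (ae_of_all _ fun y => hG _)

end CompoundExpansion

/-! ### Small jumps, large jumps and residual drift. -/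

section Decomposition

/-- The intensity `t μ` of the jumps of size at most `1/ρ`, rescaled by `ρ`. -/
def smallJumps (μ : Measure ℝ) (ρ : ℝ) (t : ℝ≥0) : Measure ℝ :=
  ((t : ℝ≥0∞) • μ.restrict {u : ℝ | |ρ * u| ≤ 1}).map (ρ * ·)

/-- The drift `t ∫_{1 ≤ |u| ≤ 1/ρ} u μ(du)` due to the small jumps that `ψ` does not compensate. -/
def midDrift (μ : Measure ℝ) (ρ : ℝ) (t : ℝ≥0) : ℝ :=
  t * ∫ u in {u : ℝ | 1 ≤ |u| ∧ |ρ * u| ≤ 1}, u ∂μ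

variable {μ : Measure ℝ} {ρ : ℝ} {t : ℝ≥0}

lemma measurableSet_abs_mul_le (ρ : ℝ) : MeasurableSet {u : ℝ | |ρ * u| ≤ 1} :=
  measurableSet_le (by fun_prop) (by fun_prop)

lemma measurableSet_one_lt_abs_mul (ρ : ℝ) : MeasurableSet {u : ℝ | 1 < |ρ * u|} :=
  measurableSet_lt (by fun_prop) (by fun_prop)

lemma measurableEmbedding_mul_left (hρ : ρ ≠ 0) : MeasurableEmbedding fun u : ℝ => ρ * u :=
  (Homeomorph.mulLeft₀ ρ hρ).measurableEmbedding

lemma integral_smallJumps {E : Type*} [NormedAddCommGroup E] [NormedSpace ℝ E] (hρ : ρ ≠ 0)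
    (f : ℝ → E) :
    ∫ v, f v ∂(smallJumps μ ρ t) = (t : ℝ) • ∫ u in {u : ℝ | |ρ * u| ≤ 1}, f (ρ * u) ∂μ := by
  rw [smallJumps, (measurableEmbedding_mul_left hρ).integral_map, integral_smul_measure,
    ENNReal.coe_toReal]

lemma integrable_smallJumps_iff {E : Type*} [NormedAddCommGroup E] (hρ : ρ ≠ 0) (ht : 0 < t)
    {f : ℝ → E} : Integrable f (smallJumps μ ρ t) ↔
      IntegrableOn (fun u => f (ρ * u)) {u : ℝ | |ρ * u| ≤ 1} μ := by
  rw [smallJumps, (measurableEmbedding_mul_left hρ).integrable_map_iff,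
    integrable_smul_measure (by simpa using ht.ne') (by simp)]
  rfl

lemma ae_smallJumps : ∀ᵐ v ∂(smallJumps μ ρ t), |v| ≤ 1 := by
  rw [smallJumps, ae_map_iff (by fun_prop) (measurableSet_le (by fun_prop) (by fun_prop))]
  exact Measure.ae_smul_measure (ae_restrict_mem (measurableSet_abs_mul_le ρ)) _

lemma integrable_sq_smallJumps (hμ : IsLevyMeasure μ) (hρ : ρ ≠ 0) (ht : 0 < t) :
    Integrable (fun v : ℝ => v ^ 2) (smallJumps μ ρ t) := by
  rw [integrable_smallJumps_iff hρ ht]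
  refine (hμ.integrable_min_sq_mul ρ).integrableOn.mono' (by fun_prop) ?_
  refine (ae_restrict_iff' (measurableSet_abs_mul_le ρ)).mpr (ae_of_all _ fun u hu => ?_)
  have hu : |ρ * u| ≤ 1 := hu
  rw [Real.norm_of_nonneg (sq_nonneg _), min_eq_left]
  rw [← sq_abs]; nlinarith [abs_nonneg (ρ * u)]

/-- With ρ = ρ_t the right side is bounded uniformly in t; this supplies the constant K of the
contour shift. -/
lemma integral_sq_smallJumps_le (hμ : IsLevyMeasure μ) (hρ : ρ ≠ 0) (ht : 0 < t) :
    ∫ v, v ^ 2 ∂(smallJumps μ ρ t) ≤ t * psiU μ ρ := by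
  rw [integral_smallJumps hρ, smul_eq_mul]
  have h := (integrable_smallJumps_iff hρ ht).mp (integrable_sq_smallJumps hμ hρ ht)
  have h1 : ∫ u in {u : ℝ | |ρ * u| ≤ 1}, (ρ * u) ^ 2 ∂μ ≤
      ∫ u in {u : ℝ | |ρ * u| ≤ 1}, min ((ρ * u) ^ 2) 1 ∂μ := by
    refine setIntegral_mono_on h (hμ.integrable_min_sq_mul ρ).integrableOn
      (measurableSet_abs_mul_le ρ) fun u hu => ?_
    have hu : |ρ * u| ≤ 1 := hu
    rw [min_eq_left]
    rw [← sq_abs]; nlinarith [abs_nonneg (ρ * u)]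
  gcongr
  exact h1.trans (setIntegral_le_integral (hμ.integrable_min_sq_mul ρ)
    (ae_of_all _ fun _ => le_min (sq_nonneg _) zero_le_one))

lemma isFiniteMeasure_Lam (hμ : IsLevyMeasure μ) (a : ℝ) (t : ℝ≥0) : IsFiniteMeasure (Lam a μ t) := by
  have : IsFiniteMeasure (μ.restrict {u : ℝ | 1 < |rho a μ t * u|}) :=
    isFiniteMeasure_restrict.mpr (hμ.one_lt_abs_mul_lt_top _).ne
  unfold Lam
  exact Measure.smul_finite _ ENNReal.coe_ne_top

lemma measure_one_le_abs_lt_top (hμ : IsLevyMeasure μ) : μ {u : ℝ | 1 ≤ |u|} < ∞ := by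
  refine lt_of_le_of_lt (measure_mono fun u hu => ?_) (hμ.integrable_min.measure_ge_lt_top one_pos)
  have hu : 1 ≤ |u| := hu
  change 1 ≤ min 1 (u ^ 2)
  refine le_min le_rfl ?_
  rw [← sq_abs]; nlinarith

/-- Here |u| ≤ 1/ρ cancels the factor ρ, leaving a mass that is finite away from 0. The remaining
factor t is why the constants depend on t₀. -/
lemma mul_abs_midDrift_le (hμ : IsLevyMeasure μ) (hρ : 0 < ρ) (t : ℝ≥0) :
    ρ * |midDrift μ ρ t| ≤ t * μ.real {u : ℝ | 1 ≤ |u|} := by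
  have hsub : {u : ℝ | 1 ≤ |u| ∧ |ρ * u| ≤ 1} ⊆ {u : ℝ | 1 ≤ |u|} := fun u hu => hu.1
  have hfin := measure_one_le_abs_lt_top hμ
  have h1 : ‖∫ u in {u : ℝ | 1 ≤ |u| ∧ |ρ * u| ≤ 1}, u ∂μ‖ ≤
      1 / ρ * μ.real {u : ℝ | 1 ≤ |u| ∧ |ρ * u| ≤ 1} := by
    refine norm_setIntegral_le_of_norm_le_const ((measure_mono hsub).trans_lt hfin) fun u hu => ?_
    have := hu.2
    rw [abs_mul, abs_of_pos hρ] at this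
    rw [Real.norm_eq_abs, le_div_iff₀ hρ]; linarith
  have h2 : μ.real {u : ℝ | 1 ≤ |u| ∧ |ρ * u| ≤ 1} ≤ μ.real {u : ℝ | 1 ≤ |u|} :=
    measureReal_mono hsub hfin.ne
  rw [midDrift, abs_mul, NNReal.abs_eq, ← Real.norm_eq_abs]
  calc ρ * (t * ‖∫ u in {u : ℝ | 1 ≤ |u| ∧ |ρ * u| ≤ 1}, u ∂μ‖)
      ≤ ρ * (t * (1 / ρ * μ.real {u : ℝ | 1 ≤ |u|})) := by gcongr; exact h1.trans (by gcongr)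
    _ = _ := by field_simp

/-- Splitting of the characteristic exponent into the compensated small jumps, the large jumps, and
the drift. -/
lemma mul_psi_eq (hμ : IsLevyMeasure μ) (a : ℝ) (ht : 0 < t) (hρ : 0 < rho a μ t) (s : ℝ) :
    ((t : ℝ) : ℂ) * psi a μ (rho a μ t * s) =
      compExponent (smallJumps μ (rho a μ t) t) s +
        ((Lam a μ t).real Set.univ - charFun (Lam a μ t) (rho a μ t * s)) +
        Complex.I * (rho a μ t * s : ℝ) * (shift a μ t - midDrift μ (rho a μ t) t) := by
  have : IsFiniteMeasure (Lam a μ t) := isFiniteMeasure_Lam hμ a t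
  have hA2 : {u : ℝ | 1 / rho a μ t < |u| ∧ |u| < 1} = {u : ℝ | 1 < |rho a μ t * u| ∧ |u| < 1} := by
    ext u
    rw [Set.mem_ofPred_eq, Set.mem_ofPred_eq, abs_mul, abs_of_pos hρ, div_lt_iff₀' hρ]
  have hLint : ∀ f : ℝ → ℂ, ∫ u, f u ∂(Lam a μ t) =
      (t : ℝ) • ∫ u in {u : ℝ | 1 < |rho a μ t * u|}, f u ∂μ := fun f => by
    rw [Lam, integral_smul_measure, ENNReal.coe_toReal]
  have hLuniv : (((Lam a μ t).real Set.univ : ℝ) : ℂ) = ∫ u, (1 : ℂ) ∂(Lam a μ t) := by simp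
  have hshift : shift a μ t = t * (a + ∫ u in {u : ℝ | 1 < |rho a μ t * u| ∧ |u| < 1}, u ∂μ) := by
    rw [shift, hA2]
  have hcomp := integrable_compExponent (ae_smallJumps (μ := μ) (ρ := rho a μ t) (t := t))
    (integrable_sq_smallJumps hμ hρ.ne' ht) s
  rw [integrable_smallJumps_iff hρ.ne' ht] at hcomp
  rw [hLuniv, charFun_apply_real, hLint, hLint, hshift, compExponent, integral_smallJumps hρ.ne',
    midDrift, psi]
  generalize rho a μ t = ρ at *
  set S := {u : ℝ | |ρ * u| ≤ 1} with hS
  set L := {u : ℝ | 1 < |ρ * u|} with hL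
  set A := {u : ℝ | 1 < |ρ * u| ∧ |u| < 1} with hA
  set B := {u : ℝ | 1 ≤ |u| ∧ |ρ * u| ≤ 1} with hB
  have hSm : MeasurableSet S := measurableSet_abs_mul_le ρ
  have hLm : MeasurableSet L := measurableSet_one_lt_abs_mul ρ
  have hAm : MeasurableSet A := hLm.inter
    (measurableSet_lt (by fun_prop) (by fun_prop) : MeasurableSet {u : ℝ | |u| < 1})
  have hBm : MeasurableSet B :=
    (measurableSet_le (by fun_prop) (by fun_prop) : MeasurableSet {u : ℝ | 1 ≤ |u|}).inter hSm
  have hLf : μ L < ∞ := hμ.one_lt_abs_mul_lt_top ρ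
  have hAf : μ A < ∞ := (measure_mono fun u hu => hu.1).trans_lt hLf
  have hBf : μ B < ∞ := (measure_mono fun u hu => hu.1).trans_lt (measure_one_le_abs_lt_top hμ)
  have iA : IntegrableOn (fun u : ℝ => (u : ℂ)) A μ := by
    refine Measure.integrableOn_of_bounded (M := 1) hAf.ne (by fun_prop)
      ((ae_restrict_iff' hAm).mpr (ae_of_all _ fun u hu => ?_))
    simpa using hu.2.le
  have iB : IntegrableOn (fun u : ℝ => (u : ℂ)) B μ := by
    refine Measure.integrableOn_of_bounded (M := 1 / ρ) hBf.ne (by fun_prop)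
      ((ae_restrict_iff' hBm).mpr (ae_of_all _ fun u hu => ?_))
    have := hu.2
    rw [abs_mul, abs_of_pos hρ] at this
    rw [Complex.norm_real, Real.norm_eq_abs, le_div_iff₀ hρ]; linarith
  have iE : IntegrableOn (fun u : ℝ => Complex.exp ((ρ * s : ℝ) * u * Complex.I)) L μ := by
    refine Measure.integrableOn_of_bounded (M := 1) hLf.ne (by fun_prop) (ae_of_all _ fun u => ?_)
    rw [← Complex.ofReal_mul, Complex.norm_exp_ofReal_mul_I]
  have i1 : IntegrableOn (fun _ : ℝ => (1 : ℂ)) L μ := integrableOn_const hLf.ne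
  have i2 : IntegrableOn (fun u : ℝ => 1 - Complex.exp ((ρ * s : ℝ) * u * Complex.I)) L μ :=
    i1.sub iE
  have jS := hcomp.integrable_indicator hSm
  have jL := i2.integrable_indicator hLm
  have jAB : Integrable (fun u => Complex.I * (ρ * s : ℝ) * (A.indicator (fun u : ℝ => (u : ℂ)) u -
      B.indicator (fun u : ℝ => (u : ℂ)) u)) μ :=
    ((iA.integrable_indicator hAm).sub (iB.integrable_indicator hBm)).const_mul _
  have key : ∫ u : ℝ, (1 - Complex.exp (Complex.I * (ρ * s : ℝ) * u) +
      (if |u| < 1 then Complex.I * (ρ * s : ℝ) * u else 0)) ∂μ =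
      (∫ u in S, (1 - Complex.exp (Complex.I * s * (ρ * u : ℝ)) + Complex.I * s * (ρ * u : ℝ)) ∂μ) +
      ((∫ u in L, (1 : ℂ) ∂μ) - ∫ u in L, Complex.exp ((ρ * s : ℝ) * u * Complex.I) ∂μ) +
      Complex.I * (ρ * s : ℝ) * ((∫ u in A, (u : ℂ) ∂μ) - ∫ u in B, (u : ℂ) ∂μ) := by
    rw [← integral_sub i1 iE, ← integral_indicator hSm, ← integral_indicator hLm,
      ← integral_indicator hAm, ← integral_indicator hBm,
      ← integral_sub (iA.integrable_indicator hAm) (iB.integrable_indicator hBm),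
      ← integral_const_mul,
      ← integral_add' jS jL, ← integral_add (jS.add jL) jAB]
    refine integral_congr_ae (ae_of_all _ fun u => ?_)
    have e1 : Complex.I * s * (ρ * u : ℝ) = Complex.I * (ρ * s : ℝ) * u := by push_cast; ring
    have e2 : ((ρ * s : ℝ) : ℂ) * u * Complex.I = Complex.I * (ρ * s : ℝ) * u := by ring
    simp only [Pi.add_apply, Set.indicator_apply, e1, e2, hS, hL, hA, hB, Set.mem_ofPred_eq]
    -- The compensators in ψ and in `compExponent` differ only on A (large jumps that ψ compensates)
    -- and on B (small jumps that it does not).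
    rcases le_or_gt |ρ * u| 1 with h1 | h1 <;> rcases lt_or_ge |u| 1 with h2 | h2
    · simp [-abs_mul, h1, h2, not_lt.mpr h1, not_le.mpr h2]
    · simp [-abs_mul, h1, h2, not_lt.mpr h1, not_lt.mpr h2]
    · simp [-abs_mul, h1, h2, not_le.mpr h1, not_le.mpr h2]
    · simp [-abs_mul, h1, h2, not_le.mpr h1, not_lt.mpr h2]
  rw [key, integral_complex_ofReal, integral_complex_ofReal]
  simp only [Complex.real_smul]
  push_cast
  ring

end Decomposition

/-! ### Derivative bounds at a fixed time. -/

section Estimate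

variable {ν μ : Measure ℝ}

/-- The modulus is exp(-t Re ψ), and the small jumps alone already force rapid decay; `exists_decay`
applies after rescaling the frequency by ρ_t/(2π). -/
lemma integrable_pow_smul_scaledCharFun [IsProbabilityMeasure ν] (hμ : IsLevyMeasure μ) (h0 : μ ≠ 0) (hA : ConditionA μ)
    (a : ℝ) {t : ℝ≥0} (ht : 0 < t)
    (hψ : ∀ ξ : ℝ, charFun ν ξ = Complex.exp (-((t : ℝ) : ℂ) * psi a μ ξ)) (n : ℕ) :
    Integrable fun w : ℝ => w ^ n • scaledCharFun ν w := by
  obtain ⟨C, hC⟩ := exists_decay hμ h0 hA a (n + 2) one_pos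
  have hρ := (rho_pos_and_re_psi_rho hμ h0 hA a ht).1
  have hpi := Real.pi_pos
  rw [← integrable_comp_mul_left_iff _ (show rho a μ t / (2 * Real.pi) ≠ 0 by positivity)]
  refine (integrable_inv_one_add_abs_sq.const_mul ((rho a μ t / (2 * Real.pi)) ^ n * C)).mono'
    (((by fun_prop : Continuous fun w : ℝ => w ^ n).smul
      continuous_scaledCharFun).comp (by fun_prop)).aestronglyMeasurable (ae_of_all _ fun s => ?_)
  have hs : 2 * Real.pi * (rho a μ t / (2 * Real.pi) * s) = s * rho a μ t := by field_simp
  have h1 : ‖scaledCharFun ν (rho a μ t / (2 * Real.pi) * s)‖ =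
      Real.exp (-(t * (psi a μ (s * rho a μ t)).re)) := by
    rw [scaledCharFun, hs, hψ, Complex.norm_exp]
    congr 1
    rw [← Complex.ofReal_neg, Complex.re_ofReal_mul]; ring
  have h2 : ∫ u in {u : ℝ | |rho a μ t * u| ≤ 1}, (1 - Real.cos (s * rho a μ t * u)) ∂μ ≤
      (psi a μ (s * rho a μ t)).re := by
    rw [psi_re hμ]
    exact setIntegral_le_integral (hμ.integrable_one_sub_cos _)
      (ae_of_all _ fun u => by simpa using Real.cos_le_one (s * rho a μ t * u))
  have h3 := hC t ht s
  rw [one_mul] at h3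
  rw [norm_smul, h1, norm_pow, Real.norm_eq_abs, abs_mul, abs_of_pos (by positivity), mul_pow,
    ← div_eq_mul_inv, le_div_iff₀ (by positivity)]
  calc (rho a μ t / (2 * Real.pi)) ^ n * |s| ^ n *
        Real.exp (-(t * (psi a μ (s * rho a μ t)).re)) * (1 + |s|) ^ 2
      ≤ (rho a μ t / (2 * Real.pi)) ^ n * (1 + |s|) ^ n *
        Real.exp (-(t * ∫ u in {u : ℝ | |rho a μ t * u| ≤ 1},
          (1 - Real.cos (s * rho a μ t * u)) ∂μ)) * (1 + |s|) ^ 2 := by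
        gcongr
        linarith
    _ = (rho a μ t / (2 * Real.pi)) ^ n * ((1 + |s|) ^ (n + 2) *
        Real.exp (-(t * ∫ u in {u : ℝ | |rho a μ t * u| ≤ 1},
          (1 - Real.cos (s * rho a μ t * u)) ∂μ))) := by ring
    _ ≤ _ := by gcongr

/-- The Fourier integral of the `k`-th derivative of the shifted density, after rescaling by
`ρ_t` and extraction of the compound Poisson factor. -/
lemma integral_scaledCharFun_eq (hμ : IsLevyMeasure μ) (a : ℝ) {t : ℝ≥0} (ht : 0 < t)
    (hρ : 0 < rho a μ t)
    (hψ : ∀ ξ : ℝ, charFun ν ξ = Complex.exp (-((t : ℝ) : ℂ) * psi a μ ξ)) (k : ℕ) (x : ℝ) :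
    ∫ w : ℝ, (-2 * Real.pi * Complex.I * w) ^ k * scaledCharFun ν w *
        Complex.exp (-2 * Real.pi * Complex.I * w * (x - shift a μ t : ℝ)) =
      (rho a μ t ^ (k + 1) * Real.exp (-(Lam a μ t).real Set.univ) / (2 * Real.pi) : ℝ) *
      ∫ s : ℝ, (-Complex.I * s) ^ k * Complex.exp (-compExponent (smallJumps μ (rho a μ t) t) s) *
        Complex.exp (Complex.I * s * (rho a μ t * midDrift μ (rho a μ t) t : ℝ)) *
        Complex.exp (charFun (Lam a μ t) (rho a μ t * s)) *
        Complex.exp (-Complex.I * s * (rho a μ t * x : ℝ)) := by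
  have hpi := Real.pi_pos
  set ρ := rho a μ t with hρdef
  have hR : 0 < ρ / (2 * Real.pi) := by positivity
  have hsub := Measure.integral_comp_mul_left (fun w : ℝ =>
    (-2 * Real.pi * Complex.I * w) ^ k * scaledCharFun ν w *
      Complex.exp (-2 * Real.pi * Complex.I * w * (x - shift a μ t : ℝ))) (ρ / (2 * Real.pi))
  rw [abs_of_pos (inv_pos.mpr hR), eq_inv_smul_iff₀ hR.ne'] at hsub
  rw [← hsub, Complex.real_smul]
  have e : ∀ s : ℝ, (-2 * Real.pi * Complex.I * (ρ / (2 * Real.pi) * s : ℝ)) ^ k *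
      scaledCharFun ν (ρ / (2 * Real.pi) * s) *
      Complex.exp (-2 * Real.pi * Complex.I * (ρ / (2 * Real.pi) * s : ℝ) *
        (x - shift a μ t : ℝ)) =
      (ρ ^ k * Real.exp (-(Lam a μ t).real Set.univ) : ℝ) *
      ((-Complex.I * s) ^ k * Complex.exp (-compExponent (smallJumps μ ρ t) s) *
        Complex.exp (Complex.I * s * (ρ * midDrift μ ρ t : ℝ)) *
        Complex.exp (charFun (Lam a μ t) (ρ * s)) *
        Complex.exp (-Complex.I * s * (ρ * x : ℝ))) := by
    intro s
    have hs : 2 * Real.pi * (ρ / (2 * Real.pi) * s) = ρ * s := by field_simp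
    have hs' : (-2 * Real.pi * Complex.I * (ρ / (2 * Real.pi) * s : ℝ) : ℂ) =
        ρ * (-Complex.I * s) := by
      calc (-2 * Real.pi * Complex.I * (ρ / (2 * Real.pi) * s : ℝ) : ℂ) =
          -Complex.I * ((2 * Real.pi * (ρ / (2 * Real.pi) * s) : ℝ) : ℂ) := by push_cast; ring
        _ = _ := by rw [hs]; push_cast; ring
    have hpsi : -((t : ℝ) : ℂ) * psi a μ (ρ * s) = -(compExponent (smallJumps μ ρ t) s +
        ((Lam a μ t).real Set.univ - charFun (Lam a μ t) (ρ * s)) +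
        Complex.I * (ρ * s : ℝ) * (shift a μ t - midDrift μ ρ t)) := by
      rw [neg_mul, mul_psi_eq hμ a ht hρ]
    have hexp : Complex.exp (-((t : ℝ) : ℂ) * psi a μ (ρ * s)) *
        Complex.exp (ρ * (-Complex.I * s) * (x - shift a μ t : ℝ)) =
        (Real.exp (-(Lam a μ t).real Set.univ) : ℝ) *
        (Complex.exp (-compExponent (smallJumps μ ρ t) s) *
          Complex.exp (Complex.I * s * (ρ * midDrift μ ρ t : ℝ)) *
          Complex.exp (charFun (Lam a μ t) (ρ * s)) *
          Complex.exp (-Complex.I * s * (ρ * x : ℝ))) := by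
      rw [hpsi, Complex.ofReal_exp]
      simp only [← Complex.exp_add]
      congr 1
      push_cast
      ring
    rw [hs', scaledCharFun, hs, hψ, mul_pow, Complex.ofReal_mul, Complex.ofReal_pow]
    linear_combination ((ρ : ℂ) ^ k * (-Complex.I * s) ^ k) * hexp
  simp only [e]
  rw [integral_const_mul, ← mul_assoc]
  congr 1
  push_cast
  ring

/-- The bound for the derivatives at a fixed time, in terms of the constants governing the small
jumps and the residual drift. -/
lemma abs_iteratedDeriv_shift_le [IsProbabilityMeasure ν] (hμ : IsLevyMeasure μ) (h0 : μ ≠ 0) (hA : ConditionA μ) (a : ℝ)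
    {t : ℝ≥0} (ht : 0 < t)
    (hψ : ∀ ξ : ℝ, charFun ν ξ = Complex.exp (-((t : ℝ) : ℂ) * psi a μ ξ)) {k : ℕ} {C K D : ℝ}
    (hK : (t : ℝ) * psiU μ (rho a μ t) ≤ K)
    (hC : ∀ s : ℝ, (1 + |s|) ^ (k + 2) * Real.exp (-(Real.exp (-1) *
      (t * ∫ u in {u : ℝ | |rho a μ t * u| ≤ 1}, (1 - Real.cos (s * rho a μ t * u)) ∂μ))) ≤ C)
    (hD : rho a μ t * |midDrift μ (rho a μ t) t| ≤ D) {b : ℝ}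
    (hb : C * Real.exp (3 * K) * (∫ s : ℝ, ((1 + |s|) ^ 2)⁻¹) * Real.exp D ≤ b) (x : ℝ) :
    |iteratedDeriv k (fun y => inversionDensity ν (y - shift a μ t)) x| ≤
      ∑' m : ℕ, 1 / (m.factorial : ℝ) *
        ∫ y, rho a μ t ^ (k + 1) * fUpper b 1 ((x - y) * rho a μ t) ∂(convPow (Lam a μ t) m) := by
  have hρ := (rho_pos_and_re_psi_rho hμ h0 hA a ht).1
  have hfin := isFiniteMeasure_Lam hμ a t
  rw [iteratedDeriv_comp_sub_const]
  refine (abs_iteratedDeriv_inversionDensity_le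
    (integrable_pow_smul_scaledCharFun hμ h0 hA a ht hψ) k _).trans ?_
  rw [integral_scaledCharFun_eq hμ a ht hρ hψ, norm_mul, Complex.norm_real]
  set ρ := rho a μ t with hρdef
  set κ := smallJumps μ ρ t
  have hκ : ∀ᵐ v ∂κ, |v| ≤ 1 := ae_smallJumps
  have hκ2 := integrable_sq_smallJumps hμ hρ.ne' ht
  have hκK : ∫ v, v ^ 2 ∂κ ≤ K := (integral_sq_smallJumps_le hμ hρ.ne' ht).trans hK
  have hκC : ∀ s : ℝ, (1 + |s|) ^ (k + 2) *
      Real.exp (-(Real.exp (-1) * ∫ v, (1 - Real.cos (s * v)) ∂κ)) ≤ C := fun s => by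
    rw [integral_smallJumps hρ.ne', smul_eq_mul]
    simp only [← mul_assoc s]
    exact hC s
  have hC0 : 0 ≤ C := le_trans (by positivity) (hC 0)
  have hJ : 0 ≤ ∫ s : ℝ, ((1 + |s|) ^ 2)⁻¹ := integral_nonneg fun s => by positivity
  have hb0 : 0 ≤ b := le_trans (by positivity) hb
  set c := ρ * midDrift μ ρ t with hc
  have hcD : |c| ≤ D := by rw [hc, abs_mul, abs_of_pos hρ]; exact hD
  have hG : ∀ y : ℝ, ‖∫ s : ℝ, (-Complex.I * s) ^ k * Complex.exp (-compExponent κ s) *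
      Complex.exp (Complex.I * s * c) * Complex.exp (-Complex.I * s * y)‖ ≤ fUpper b 1 y := by
    intro y
    have h := norm_integral_exp_compExponent_le hκ hκ2 hκK hκC (y - c)
    have e : ∀ s : ℝ, (-Complex.I * s) ^ k * Complex.exp (-compExponent κ s) *
        Complex.exp (-Complex.I * s * (y - c : ℝ)) =
        (-Complex.I * s) ^ k * Complex.exp (-compExponent κ s) *
        Complex.exp (Complex.I * s * c) * Complex.exp (-Complex.I * s * y) := fun s => by
      rw [mul_assoc _ (Complex.exp (Complex.I * s * c)), ← Complex.exp_add]
      congr 2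
      push_cast; ring
    simp only [e] at h
    refine h.trans ?_
    -- The residual drift translates by c with |c| ≤ D, at the price of the factor e^D.
    have h1 : Real.exp (-|y - c|) ≤ Real.exp D * Real.exp (-|y|) := by
      rw [← Real.exp_add, Real.exp_le_exp]
      have := abs_sub_abs_le_abs_sub y c
      linarith
    calc _ ≤ C * Real.exp (3 * K) * (∫ s : ℝ, ((1 + |s|) ^ 2)⁻¹) *
          (Real.exp D * Real.exp (-|y|)) := by gcongr
      _ = C * Real.exp (3 * K) * (∫ s : ℝ, ((1 + |s|) ^ 2)⁻¹) * Real.exp D * Real.exp (-|y|) := by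
          ring
      _ ≤ b * Real.exp (-|y|) := by gcongr
      _ = _ := by rw [fUpper, neg_one_mul]
  have hW : Integrable fun s : ℝ => (-Complex.I * s) ^ k * Complex.exp (-compExponent κ s) *
      Complex.exp (Complex.I * s * c) := by
    have h := integrable_pow_mul_exp_neg_compExponent hκ hκ2 hκK hκC
    refine h.norm.mono' (h.aestronglyMeasurable.mul (by fun_prop)) (ae_of_all _ fun s => ?_)
    have : ‖Complex.exp (Complex.I * s * c)‖ = 1 := by rw [Complex.norm_exp]; simp
    rw [norm_mul, this, mul_one]
  have hmain := norm_integral_mul_exp_charFun_le (Q := Lam a μ t) hW (F := fUpper b 1)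
    (by unfold fUpper; fun_prop) (B := b) (fun y => by
      rw [fUpper, abs_of_nonneg (by positivity)]
      exact mul_le_of_le_one_right hb0 (by
        rw [Real.exp_le_one_iff]; linarith [abs_nonneg y])) hG ρ x
  -- Both e^{-|Λ_t|} and 1/(2π) are at most 1 and are discarded.
  have hcoef : ‖ρ ^ (k + 1) * Real.exp (-(Lam a μ t).real Set.univ) / (2 * Real.pi)‖ ≤
      ρ ^ (k + 1) := by
    rw [Real.norm_of_nonneg (by positivity), div_le_iff₀ (by positivity)]
    have h1 : Real.exp (-(Lam a μ t).real Set.univ) ≤ 1 := by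
      rw [Real.exp_le_one_iff]; linarith [measureReal_nonneg (μ := Lam a μ t) (s := Set.univ)]
    have h2 : (1 : ℝ) ≤ 2 * Real.pi := by linarith [Real.pi_gt_three]
    gcongr
    linarith
  calc _ ≤ ρ ^ (k + 1) * ∑' m : ℕ, 1 / (m.factorial : ℝ) *
        ∫ y, fUpper b 1 (ρ * (x - y)) ∂(convPow (Lam a μ t) m) := by gcongr
    _ = _ := by
        rw [← tsum_mul_left]
        refine tsum_congr fun m => ?_
        rw [integral_const_mul]
        simp only [mul_comm ρ]
        ring

end Estimate

end CompoundKernel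

end

/-! ### The main theorem: choice of uniform constants. -/

theorem theorem3 {Ω : Type*} [MeasurableSpace Ω] (P : Measure Ω) [IsProbabilityMeasure P]
    (Z : ℝ≥0 → Ω → ℝ) (hZ : CompoundKernel.IsLevyProcess Z P)
    (a : ℝ) (μ : Measure ℝ) (hμ : CompoundKernel.IsLevyMeasure μ) (hμ_inf : μ Set.univ = ∞)
    (hψ : ∀ (t : ℝ≥0) (ξ : ℝ),
      charFun (P.map (Z t)) ξ = Complex.exp (-((t : ℝ) : ℂ) * CompoundKernel.psi a μ ξ))
    (hA : CompoundKernel.ConditionA μ) :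
    ∃ p : ℝ≥0 → ℝ → ℝ,
      (∀ t : ℝ≥0, 0 < t → CompoundKernel.IsSmoothDensity (P.map (Z t)) (p t)) ∧
      ∀ k : ℕ, 1 ≤ k → ∀ t₀ : ℝ≥0, 0 < t₀ → ∃ b₁ b₂ : ℝ, 0 < b₁ ∧ 0 < b₂ ∧
        CompoundKernel.UpperCompoundKernelEstimate (Set.Ioc 0 t₀ ×ˢ Set.univ)
          (fun t x => |iteratedDeriv k (fun y => p t (y - CompoundKernel.shift a μ t)) x|)
          (fun t => CompoundKernel.rho a μ t ^ (k + 1))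
          (CompoundKernel.fUpper b₁ b₂)
          (CompoundKernel.rho a μ)
          (CompoundKernel.Lam a μ) := by
  open CompoundKernel in
  have h0 : μ ≠ 0 := fun h => by simp [h] at hμ_inf
  have hprob : ∀ t, IsProbabilityMeasure (P.map (Z t)) := fun t =>
    Measure.isProbabilityMeasure_map (hZ.measurable t).aemeasurable
  refine ⟨fun t => inversionDensity (P.map (Z t)), fun t ht => isSmoothDensity_inversionDensity
    (integrable_pow_smul_scaledCharFun hμ h0 hA a ht (hψ t)), fun k _ t₀ _ => ?_⟩
  -- The rate e^{-1} is what survives on the shifted contour.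
  obtain ⟨C, hC⟩ := exists_decay hμ h0 hA a (k + 2) (Real.exp_pos (-1))
  obtain ⟨K, -, hK⟩ := mul_psiU_rho_bounds hμ h0 hA a
  obtain ⟨b, hb, hb0⟩ : ∃ b : ℝ, C * Real.exp (3 * K) * (∫ s : ℝ, ((1 + |s|) ^ 2)⁻¹) *
      Real.exp (t₀ * μ.real {u : ℝ | 1 ≤ |u|}) ≤ b ∧ 0 < b :=
    ⟨max _ 1, le_max_left _ _, lt_max_of_lt_right one_pos⟩
  -- The rate b₂ = 1 is the height of the contour shift in the rescaled variable.
  refine ⟨b, 1, hb0, one_pos, fun t x htx => ?_⟩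
  obtain ⟨ht, htt⟩ : 0 < t ∧ t ≤ t₀ := htx.1
  have hρ := (rho_pos_and_re_psi_rho hμ h0 hA a ht).1
  have hfin := isFiniteMeasure_Lam hμ a t
  have hB : ∀ y, |rho a μ t ^ (k + 1) * fUpper b 1 ((x - y) * rho a μ t)| ≤
      rho a μ t ^ (k + 1) * b := fun y => by
    rw [fUpper, abs_of_nonneg (by positivity)]
    gcongr
    refine mul_le_of_le_one_right hb0.le ?_
    rw [Real.exp_le_one_iff]; linarith [abs_nonneg ((x - y) * rho a μ t)]
  refine ⟨hfin, fun m => integrable_convPow (by unfold fUpper; fun_prop) hB m,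
    summable_convPow hB, ?_⟩
  refine abs_iteratedDeriv_shift_le hμ h0 hA a ht (hψ t) (hK t ht).2 (hC t ht)
    ((mul_abs_midDrift_le hμ hρ t).trans ?_) hb x
  gcongr
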